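/- Let $k\ge 1$. An array of $n$ distinct keys is sorted by $k$-pivot Quicksort: if $n\ge k$, the $k$ rightmost keys are the pivots; the other $n-k$ keys are partitioned, in their order in the array, into the $k+1$ subarrays delimited by the sorted pivots; and each subarray is treated recursively. An array $\ell$ with at least $k$ keys incurs a toll $\tau(\ell)\in\mathbb R$ for its partitioning stage, arrays with fewer than $k$ keys cost nothing, and the cost of a run is the sum of all tolls. Assume that the average of $\tau$ over the $n!$ orderings of any $n\ge k$ distinct keys is $an+b$, with $a=\bar a(k)$, $b=\bar b(k)$ real. Let $a_n$ be the expected cost when all $n!$ orderings of the keys $1,\dots,n$ are equally likely, $H_n=\sum_{j=1}^n 1/j$, $A=\frac{a}{H_{k+1}-1}$, $x^{\underline m}=x(x-1)\cdots(x-m+1)$, $\gamma$ Euler's constant, and ${m\brace j}$ the Stirling numbers of the second kind. **(1) Roots.** The polynomial $\mathcal P_k(\Theta)=(-1)^k\Theta^{\underline k}-(k+1)!$ has $k$ distinct complex roots $r_1,\dots,r_k$ with $r_k=-2$ and $-2<\Re r_i\le k+1$ for $i<k$; its real roots are $-2$ and, if $k$ is even, $k+1$; exactly $\lfloor\frac{k-1}2\rfloor$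 roots have positive imaginary part. Moreover $(-1)^n\binom{r_i}{n}=O(n^{-(\Re r_i+1)})$ for every $i$. The roots depend only on $k$. **(2) Recurrence and differential equation.** $a_n=0$ for $n<k$, and for $n\ge k$ $$\binom nk a_n=\binom nk(an+b)+(k+1)\sum_{i=1}^{n-k+1}\binom{n-i}{k-1}a_{i-1}.$$ The series $h(x)=\sum_{n\ge0}a_nx^n$ converges for complex $|x|<1$ and satisfies there the Cauchy–Euler equation $$\frac{h^{(k)}(x)(1-x)^k}{k!}=\frac{a(x+k)+b(1-x)}{(1-x)^2}+(k+1)h(x).$$ **(3) Integration constants.** The linear system $$\sum_{i=1}^k s_i r_i^{\underline m}=c_m:=(-1)^{m+1}m!\Bigl(A\bigl((m+1)H_m-m\bigr)+\frac{a-b}{k}\Bigr),\qquad 0\le m<k,$$ is equivalent to the Vandermonde system $\sum_i s_i r_i^m=\sum_{j=0}^m{m\brace j}c_j$, $0\le m<k$, whose determinant is nonzero. It has a unique solution $(s_1,\dots,s_k)\in\mathbb C^k$, and $s_k$ is real. **(4) Solution.** For $|x|<1$, $$h(x)=-A\frac{\log(1-x)}{(1-x)^2}+\frac{a-b}{k}\cdot\frac1{1-x}+\sum_{i=1}^k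 s_i(1-x)^{r_i}$$ (principal branches), and for every $n\ge0$ $$a_n=A\bigl((n+1)H_n-n\bigr)+\sum_{i=1}^k s_i(-1)^n\binom{r_i}{n}+\frac{a-b}{k}.$$ **(5) Asymptotics.** As $n\to\infty$, $$a_n=A\bigl((n+1)H_n-n\bigr)+s_k(n+1)+2\sum_{i:\,\Im r_i>0}(-1)^n\Re\Bigl(s_i\binom{r_i}{n}\Bigr)+O(1),$$ $$a_n=A\bigl((n+1)H_n-n\bigr)+s_k(n+1)+o(n)=A\,n\log n+\bigl(s_k+A(\gamma-1)\bigr)n+o(n),$$ and in particular $a_n=A\,n\log n+O(n)$. **(6) Partitioning stages.** For the toll $\tau\equiv1$ (so $a=0$, $b=1$) the Vandermonde system is $\sum_i s_i r_i^m=(-1)^m/k$, $0\le m<k$, with solution $$s_i=(-1)^{k-1}\frac{\prod_{j\ne i}(r_j+1)}{k\prod_{j\ne i}(r_i-r_j)},\qquad s_k=\frac1{(k+1)(H_{k+1}-1)},$$ and the expected number of partitioning stages is $$\frac{n+1}{(k+1)(H_{k+1}-1)}+o(n).$$ -/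

import Mathlib

namespace MultipivotQuicksort

open scoped Nat BigOperators

/-! ### The algorithm -/

/-- The pivots of an array: its `k` rightmost keys. -/
def pivots (k : ℕ) (l : List ℕ) : List ℕ := l.drop (l.length - k)

/-- The keys that are not pivots, in their order in the array. -/
def nonPivots (k : ℕ) (l : List ℕ) : List ℕ := l.take (l.length - k)

/-- The `j`-th subarray after partitioning: the non-pivot keys that are larger than exactly `j`
of the pivots. For distinct keys and `0 ≤ j ≤ k` these are the `k + 1` segments delimited by the
sorted pivots. -/
def segment (k : ℕ) (l : List ℕ) (j : ℕ) : List ℕ :=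
  (nonPivots k l).filter (fun x => (pivots k l).countP (fun p => p < x) = j)

theorem segment_length_lt {k : ℕ} {l : List ℕ} (hk : 0 < k) (hl : k ≤ l.length) (j : ℕ) :
    (segment k l j).length < l.length := by
  have h1 : (segment k l j).length ≤ (nonPivots k l).length := List.length_filter_le _ _
  have h2 : (nonPivots k l).length ≤ l.length - k := by
    simp [nonPivots]
  omega

/-- Total cost of `k`-pivot Quicksort on the array `l`: an array with at least `k` keys
contributes the toll `τ l` of its partitioning stage plus the costs of its `k + 1` subarrays;
an array with fewer than `k` keys contributes nothing. -/
noncomputable def cost (k : ℕ) (τ : List ℕ → ℝ) (l : List ℕ) : ℝ :=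
  if _h : 0 < k ∧ k ≤ l.length then
    τ l + ∑ j ∈ Finset.range (k + 1), cost k τ (segment k l j)
  else 0
termination_by l.length
decreasing_by exact segment_length_lt _h.1 _h.2 _

/-- All arrays in which each key of `s` occurs exactly once. -/
def orderings (s : Finset ℕ) : Finset (List ℕ) := (Multiset.lists s.val).toFinset

theorem mem_orderings {s : Finset ℕ} {l : List ℕ} :
    l ∈ orderings s ↔ l.Nodup ∧ l.toFinset = s := by
  simp only [orderings, Multiset.mem_toFinset, Multiset.mem_lists_iff]
  constructor
  · intro h
    have hn : l.Nodup := by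
      have h2 := s.nodup
      rw [h] at h2
      exact Multiset.coe_nodup.mp h2
    refine ⟨hn, ?_⟩
    apply Finset.val_injective
    rw [h, List.toFinset_val, hn.dedup]
    rfl
  · rintro ⟨hn, rfl⟩
    rw [List.toFinset_val, hn.dedup]
    rfl

/-- Expectation of `F` over a uniformly random arrangement of the keys in `s`. -/
noncomputable def average (s : Finset ℕ) (F : List ℕ → ℝ) : ℝ :=
  (∑ l ∈ orderings s, F l) / (s.card ! : ℝ)

/-- Expected cost on the keys `1, …, n`, all `n!` permutations being equally likely. -/
noncomputable def expectedCost (k : ℕ) (τ : List ℕ → ℝ) (n : ℕ) : ℝ :=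
  average (Finset.Icc 1 n) (cost k τ)

/-- Partitioning `n ≥ k` distinct keys in uniformly random order has average toll `a n + b`. -/
def HasAverageToll (k : ℕ) (τ : List ℕ → ℝ) (a b : ℝ) : Prop :=
  ∀ s : Finset ℕ, k ≤ s.card → average s τ = a * s.card + b

/-- Expected number of partitioning stages (every stage has toll one). -/
noncomputable def expectedStages (k n : ℕ) : ℝ := expectedCost k (fun _ => 1) n

/-! ### The differential equation and its integration constants -/

/-- The generating function of the expected costs. -/
noncomputable def genFun (k : ℕ) (τ : List ℕ → ℝ) (x : ℂ) : ℂ :=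
  ∑' n : ℕ, (expectedCost k τ n : ℂ) * x ^ n

/-- The indicial polynomial `(-1)^k Θ(Θ-1)⋯(Θ-k+1) - (k+1)!`. -/
noncomputable def indicialPoly (k : ℕ) : Polynomial ℂ :=
  Polynomial.C ((-1 : ℂ) ^ k) * descPochhammer ℂ k - Polynomial.C (((k + 1)! : ℕ) : ℂ)

/-- The harmonic number `H_n` as a real number. -/
noncomputable def H (n : ℕ) : ℝ := ((harmonic n : ℚ) : ℝ)

/-- The leading constant `a / (H_{k+1} - 1)`. -/
noncomputable def lead (k : ℕ) (a : ℝ) : ℝ := a / (H (k + 1) - 1)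

/-- Right-hand side of the `m`-th linear equation for the integration constants. -/
noncomputable def sysRHS (k : ℕ) (a b : ℝ) (m : ℕ) : ℝ :=
  (-1) ^ (m + 1) * (m ! : ℝ) * (lead k a * ((m + 1) * H m - m) + (a - b) / k)

/-- `s` solves the linear system `∑ i, s_i (r_i)(r_i-1)⋯(r_i-m+1) = sysRHS m`, `0 ≤ m < k`. -/
def IsIntegrationConstants (k : ℕ) (a b : ℝ) (r s : Fin k → ℂ) : Prop :=
  ∀ m : Fin k, ∑ i, s i * (descPochhammer ℂ (m : ℕ)).eval (r i) = (sysRHS k a b m : ℂ)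

end MultipivotQuicksort

namespace MultipivotQuicksort
open scoped Nat BigOperators

/-! Randomness is preserved by partitioning. Given the set of pivots, the other keys are in
uniformly random order, and filtering keeps the survivors in uniformly random order
(`average_comp_filter`, `average_segment`). Hence the average cost depends only on the number of
keys. Moreover, the number of pivot sets whose `j`-th gap has `m` elements does not depend on `j`
(`sum_card_segmentSet`), so all segments contribute alike, which gives the recurrence.

The recurrence is solved directly on coefficients. Let `binomCoeff r n` be the coefficient of `x ^
n` in `(1 - x) ^ r`. The left side of the recurrence is `k`-fold differentiation and the sum is
multiplication by `(1 - x) ^ (-k)`; both turn `(1 - x) ^ r` into a multiple of `(1 - x) ^ (r - k)`.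
The two multiples agree exactly when `r` is a root of the indicial polynomial
(`binomCoeff_recurrence`). A particular solution is a combination of `(n + 1) H_n - n` and a
constant, because products of a binomial coefficient and a harmonic difference obey Pascal's rule.
The `k` initial zeros form the linear system for the integration constants, which is solvable
because the roots are distinct. Summing the closed form gives convergence and the formula for the
generating function; the differential equation is the recurrence read as an identity of power
series.

The roots are located by comparing the factors of `∏ (j - z)` with those at `-2` and at `k + 1`.
They are simple because the logarithmic derivative does not vanish at them. Since `-2` is the root
of least real part, it alone among the roots contributes at order `n`; the growth of `binomCoeff r
n` comes from Euler's limit for the Gamma function. -/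

/-! ### Averages over random orderings. -/

theorem sum_orderings_toFinset {l : List ℕ} (hl : l.Nodup) (F : List ℕ → ℝ) :
    ∑ m ∈ orderings l.toFinset, F m = (l.permutations'.map F).sum := by
  have h : orderings l.toFinset = l.permutations'.toFinset := by
    ext m
    rw [mem_orderings, List.mem_toFinset, List.mem_permutations']
    constructor
    · rintro ⟨h1, h2⟩
      exact List.perm_of_nodup_nodup_toFinset_eq h1 hl h2
    · intro h
      exact ⟨h.nodup_iff.mpr hl, List.toFinset_eq_of_perm _ _ h⟩
  rw [h, List.sum_toFinset _ ((List.permutations_perm_permutations' l).nodup_iff.mp (List.nodup_permutations l hl))]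

theorem length_of_mem_orderings {s : Finset ℕ} {l : List ℕ} (h : l ∈ orderings s) :
    l.length = s.card := by
  obtain ⟨h1, rfl⟩ := mem_orderings.mp h
  exact (List.toFinset_card_of_nodup h1).symm

/-- Inserting a key that `G` ignores does not change the average of `G`. -/
theorem average_insert {x : ℕ} {T : Finset ℕ} (hx : x ∉ T) (G : List ℕ → ℝ)
    (hG : ∀ l, ∀ m ∈ List.permutations'Aux x l, G m = G l) :
    average (insert x T) G = average T G := by
  have hn : (x :: T.toList).Nodup := by
    rw [List.nodup_cons]; exact ⟨by simpa using hx, T.nodup_toList⟩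
  have hf : (x :: T.toList).toFinset = insert x T := by simp
  have hf' : T.toList.toFinset = T := by simp
  -- Each ordering of `T` extends in `T.card + 1` ways, one for each place of `x`. The recursion of
  -- `permutations'` makes exactly these insertions.
  have key : ∑ m ∈ orderings (insert x T), G m = (T.card + 1) * ∑ m ∈ orderings T, G m := by
    rw [← hf, sum_orderings_toFinset hn]
    conv_rhs => rw [← hf', sum_orderings_toFinset T.nodup_toList, List.toFinset_card_of_nodup T.nodup_toList]
    rw [List.permutations', List.map_flatMap, List.flatMap_def, List.sum_flatten, List.map_map, ← List.sum_map_mul_left]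
    congr 1
    apply List.map_congr_left
    intro l hl
    have hlen : l.length = T.toList.length := by
      rw [List.mem_permutations'] at hl
      rw [hl.length_eq]
    rw [Function.comp_apply, List.map_congr_left (hG l), List.map_const', List.sum_replicate, List.length_permutations'Aux,
      hlen]
    simp
  rw [average, average, key, Finset.card_insert_of_notMem hx, Nat.factorial_succ]
  have : (T.card ! : ℝ) ≠ 0 := by positivity
  push_cast
  field_simp

theorem filter_of_mem_permutations'Aux {p : ℕ → Bool} {x : ℕ} (hx : p x = false) (l : List ℕ) :
    ∀ m ∈ List.permutations'Aux x l, m.filter p = l.filter p := by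
  induction l with
  | nil => intro m hm; simp at hm; simp [hm, hx]
  | cons y l ih =>
    intro m hm
    simp only [List.permutations'Aux, List.mem_cons, List.mem_map] at hm
    rcases hm with rfl | ⟨m, hm, rfl⟩
    · rw [List.filter_cons_of_neg (by simp [hx])]
    · simp only [List.filter_cons, ih m hm]

theorem average_congr {s : Finset ℕ} {F G : List ℕ → ℝ} (h : ∀ l ∈ orderings s, F l = G l) :
    average s F = average s G := by
  rw [average, average, Finset.sum_congr rfl h]

/-- The keys of a uniformly random array that satisfy `p` are again in uniformly random order. -/
theorem average_comp_filter (T : Finset ℕ) (p : ℕ → Bool) (F : List ℕ → ℝ) :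
    average T (fun l => F (l.filter p)) = average (T.filter (fun x => p x)) F := by
  -- Rejected keys are added one at a time, so the set `A` of rejected keys is made arbitrary for
  -- the induction.
  have h : ∀ A : Finset ℕ, (∀ x ∈ A, p x = false) →
      average (A ∪ T.filter (fun x => p x)) (fun l => F (l.filter p))
        = average (T.filter (fun x => p x)) F := by
    intro A
    induction A using Finset.induction_on with
    | empty =>
      intro _
      rw [Finset.empty_union]
      refine average_congr fun l hl => ?_
      rw [List.filter_eq_self.mpr]
      intro a ha
      have : a ∈ T.filter (fun x => p x) := by
        rw [← (mem_orderings.mp hl).2]; simpa using ha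
      simpa using (Finset.mem_filter.mp this).2
    | insert x A hxA ih =>
      intro hA
      have hx : p x = false := hA x (by simp)
      rw [Finset.insert_union, average_insert, ih fun y hy => hA y (by simp [hy])]
      · simp [hxA, hx]
      · intro l m hm
        simp only [filter_of_mem_permutations'Aux hx l m hm]
  rw [← h (T.filter (fun x => p x = false)) (by simp)]
  congr 1
  ext x
  cases hp : p x <;> simp [hp]

/-! ### Conditioning on the set of pivots. -/

/-- The `j`-th segment of the key set `s` for the pivot set `P`. -/
def segmentSet (s P : Finset ℕ) (j : ℕ) : Finset ℕ :=
  (s \ P).filter (fun x => (P.filter (fun p => p < x)).card = j)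

theorem countP_lt_eq_card {p : List ℕ} (hp : p.Nodup) (x : ℕ) :
    p.countP (fun y => y < x) = (p.toFinset.filter (fun y => y < x)).card := by
  rw [List.countP_eq_length_filter, ← List.toFinset_card_of_nodup (hp.filter _), List.toFinset_filter]
  simp

/-- An array is the concatenation of its non-pivots and its pivots, so it amounts to a set of pivots
together with independent orderings of that set and of its complement. -/
theorem sum_orderings_split {s : Finset ℕ} {k : ℕ} (hk : k ≤ s.card) (G : List ℕ → List ℕ → ℝ) :
    ∑ l ∈ orderings s, G (nonPivots k l) (pivots k l)
      = ∑ P ∈ s.powersetCard k, ∑ p ∈ orderings P, ∑ q ∈ orderings (s \ P), G q p := by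
  simp_rw [← Finset.sum_product']
  rw [Finset.sum_sigma']
  symm
  refine Finset.sum_bij' (fun x _ => x.2.2 ++ x.2.1)
    (fun l _ => ⟨(pivots k l).toFinset, (pivots k l, nonPivots k l)⟩) ?_ ?_ ?_ ?_ ?_
  · rintro ⟨P, p, q⟩ h
    simp only [Finset.mem_sigma, Finset.mem_powersetCard, Finset.mem_product, mem_orderings] at h
    obtain ⟨⟨hP, -⟩, ⟨hp, rfl⟩, hq, hq'⟩ := h
    rw [mem_orderings]
    refine ⟨?_, ?_⟩
    · rw [List.nodup_append']
      refine ⟨hq, hp, ?_⟩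
      intro a ha ha'
      have : a ∈ q.toFinset := by simpa using ha
      rw [hq'] at this
      simp [ha'] at this
    · rw [List.toFinset_append, hq']
      exact Finset.sdiff_union_of_subset hP
  · intro l hl
    have hlen := length_of_mem_orderings hl
    obtain ⟨hn, rfl⟩ := mem_orderings.mp hl
    simp only [Finset.mem_sigma, Finset.mem_powersetCard, Finset.mem_product, mem_orderings]
    have h1 : (pivots k l).Nodup := hn.sublist (List.drop_sublist _ _)
    have h2 : (nonPivots k l).Nodup := hn.sublist (List.take_sublist _ _)
    refine ⟨⟨?_, ?_⟩, ⟨h1, trivial⟩, h2, ?_⟩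
    · intro a ha
      rw [List.mem_toFinset] at ha ⊢
      exact List.mem_of_mem_drop ha
    · rw [List.toFinset_card_of_nodup h1, pivots, List.length_drop]
      omega
    · have hl' : nonPivots k l ++ pivots k l = l := List.take_append_drop _ _
      have hn' := hn
      rw [← hl', List.nodup_append'] at hn'
      ext a
      simp only [List.mem_toFinset, Finset.mem_sdiff]
      constructor
      · intro ha
        exact ⟨List.mem_of_mem_take ha, fun h => hn'.2.2 ha h⟩
      · rintro ⟨ha, ha'⟩
        rw [← hl', List.mem_append] at ha
        exact ha.resolve_right ha'
  · rintro ⟨P, p, q⟩ h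
    simp only [Finset.mem_sigma, Finset.mem_powersetCard, Finset.mem_product, mem_orderings] at h
    obtain ⟨⟨hP, hc⟩, ⟨hp, rfl⟩, hq, hq'⟩ := h
    have hpl : p.length = k := by rw [← hc, List.toFinset_card_of_nodup hp]
    have e1 : pivots k (q ++ p) = p := by
      rw [pivots, List.length_append, hpl, Nat.add_sub_cancel, List.drop_left]
    have e2 : nonPivots k (q ++ p) = q := by
      rw [nonPivots, List.length_append, hpl, Nat.add_sub_cancel, List.take_left]
    simp [e1, e2]
  · intro l hl
    exact List.take_append_drop _ _
  · rintro ⟨P, p, q⟩ h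
    simp only [Finset.mem_sigma, Finset.mem_powersetCard, Finset.mem_product, mem_orderings] at h
    obtain ⟨⟨hP, hc⟩, ⟨hp, rfl⟩, hq, hq'⟩ := h
    have hpl : p.length = k := by rw [← hc, List.toFinset_card_of_nodup hp]
    have e1 : pivots k (q ++ p) = p := by
      rw [pivots, List.length_append, hpl, Nat.add_sub_cancel, List.drop_left]
    have e2 : nonPivots k (q ++ p) = q := by
      rw [nonPivots, List.length_append, hpl, Nat.add_sub_cancel, List.take_left]
    simp only [e1, e2]

theorem card_orderings (s : Finset ℕ) : (orderings s).card = s.card ! := by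
  have h := sum_orderings_toFinset s.nodup_toList (fun _ => 1)
  rw [Finset.toList_toFinset] at h
  have h' : ((orderings s).card : ℝ) = (s.card ! : ℕ) := by
    simpa [(List.permutations_perm_permutations' _).length_eq.symm, List.length_permutations] using h
  exact_mod_cast h'

theorem sum_orderings_eq (s : Finset ℕ) (F : List ℕ → ℝ) :
    ∑ l ∈ orderings s, F l = s.card ! * average s F := by
  rw [average]
  field_simp

/-- The filter that cuts out a segment sees the pivots only through their set `P`, so the inner
average is one over `segmentSet s P j`. The factor `k! (n - k)!` left by each `P` turns `n!` into
the binomial coefficient. -/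
theorem average_segment {s : Finset ℕ} {k : ℕ} (hk : k ≤ s.card) (j : ℕ) (F : List ℕ → ℝ) :
    (s.card.choose k : ℝ) * average s (fun l => F (segment k l j))
      = ∑ P ∈ s.powersetCard k, average (segmentSet s P j) F := by
  have h := sum_orderings_split hk
    (fun q p => F (q.filter (fun x => p.countP (fun y => y < x) = j)))
  have h2 : ∀ P ∈ s.powersetCard k, (∑ p ∈ orderings P, ∑ q ∈ orderings (s \ P),
      F (q.filter (fun x => p.countP (fun y => y < x) = j)))
      = (k ! * (s.card - k)! : ℝ) * average (segmentSet s P j) F := by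
    intro P hP
    obtain ⟨hPs, hPc⟩ := Finset.mem_powersetCard.mp hP
    have h3 : ∀ p ∈ orderings P, (∑ q ∈ orderings (s \ P),
        F (q.filter (fun x => p.countP (fun y => y < x) = j)))
        = ((s.card - k)! : ℝ) * average (segmentSet s P j) F := by
      intro p hp
      obtain ⟨hp1, rfl⟩ := mem_orderings.mp hp
      rw [sum_orderings_eq, average_comp_filter, Finset.card_sdiff_of_subset hPs, hPc]
      congr 2
      simp only [segmentSet, countP_lt_eq_card hp1, decide_eq_true_eq]
    rw [Finset.sum_congr rfl h3, Finset.sum_const, card_orderings, hPc, nsmul_eq_mul, mul_assoc]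
  rw [Finset.sum_congr rfl h2, ← Finset.mul_sum] at h
  have h4 : ∑ l ∈ orderings s, F (segment k l j) = s.card ! * average s (fun l => F (segment k l j)) :=
    sum_orderings_eq _ _
  unfold segment at h4 ⊢
  rw [h4, ← Nat.choose_mul_factorial_mul_factorial hk] at h
  push_cast at h
  have h5 : ((k ! : ℝ) * (s.card - k)!) ≠ 0 := by positivity
  apply mul_left_cancel₀ h5
  rw [← h]
  ring


/-! ### Counting pivot sets by the size of one gap. -/

theorem sum_powersetCard_insert {x : ℕ} {s : Finset ℕ} (hx : x ∉ s) (k : ℕ) (f : Finset ℕ → ℝ) :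
    ∑ P ∈ (insert x s).powersetCard (k + 1), f P
      = ∑ P ∈ s.powersetCard (k + 1), f P + ∑ P ∈ s.powersetCard k, f (insert x P) := by
  rw [Finset.powersetCard_succ_insert hx, Finset.sum_union, Finset.sum_image]
  · intro P hP Q hQ h
    have h1 : x ∉ P := fun h => hx ((Finset.mem_powersetCard.mp hP).1 h)
    have h2 : x ∉ Q := fun h => hx ((Finset.mem_powersetCard.mp hQ).1 h)
    rw [← Finset.erase_insert h1, ← Finset.erase_insert h2]
    exact congrArg (fun s => s.erase x) h
  · rw [Finset.disjoint_left]
    intro P hP hP'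
    obtain ⟨Q, -, rfl⟩ := Finset.mem_image.mp hP'
    exact hx ((Finset.mem_powersetCard.mp hP).1 (Finset.mem_insert_self _ _))

theorem segmentSet_insert_insert {x : ℕ} {s P : Finset ℕ} (hx : ∀ y ∈ s, y < x)
    (j : ℕ) : segmentSet (insert x s) (insert x P) j = segmentSet s P j := by
  have hxs : x ∉ s := fun h => lt_irrefl _ (hx x h)
  ext y
  simp only [segmentSet, Finset.mem_filter, Finset.mem_sdiff, Finset.mem_insert]
  have h : ∀ y ∈ s, (insert x P).filter (fun p => p < y) = P.filter (fun p => p < y) := by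
    intro y hy
    rw [Finset.filter_insert, if_neg (not_lt.mpr (hx y hy).le)]
  constructor
  · rintro ⟨⟨h1, h2⟩, h3⟩
    push Not at h2
    have hy := h1.resolve_left h2.1
    rw [h y hy] at h3
    exact ⟨⟨hy, h2.2⟩, h3⟩
  · rintro ⟨⟨h1, h2⟩, h3⟩
    refine ⟨⟨Or.inr h1, ?_⟩, by rw [h y h1]; exact h3⟩
    push Not
    exact ⟨fun e => hxs (e ▸ h1), h2⟩

theorem segmentSet_insert {x : ℕ} {s P : Finset ℕ} (hx : ∀ y ∈ s, y < x) (hP : P ⊆ s)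
    (j : ℕ) : segmentSet (insert x s) P j
      = if P.card = j then insert x (segmentSet s P j) else segmentSet s P j := by
  have hxs : x ∉ s := fun h => lt_irrefl _ (hx x h)
  have hxP : x ∉ P := fun h => hxs (hP h)
  have h : P.filter (fun p => p < x) = P :=
    Finset.filter_eq_self.mpr fun p hp => hx p (hP hp)
  rw [segmentSet, Finset.insert_sdiff_of_notMem _ hxP, Finset.filter_insert, h]
  rfl

theorem segmentSet_eq_empty {s P : Finset ℕ} {j : ℕ} (h : P.card < j) : segmentSet s P j = ∅ := by
  rw [segmentSet, Finset.filter_eq_empty_iff]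
  intro x _
  exact ((Finset.card_filter_le _ _).trans_lt h).ne

theorem segmentSet_card_le (s P : Finset ℕ) (j : ℕ) (hP : P ⊆ s) :
    (segmentSet s P j).card ≤ s.card - P.card := by
  rw [← Finset.card_sdiff_of_subset hP]
  exact Finset.card_filter_le _ _

/-- The number of `(k+1)`-subsets of `s` whose `j`-th gap contains `m` elements is
`(|s| - 1 - m).choose k`. -/
theorem sum_card_segmentSet (s : Finset ℕ) : ∀ (k j : ℕ) (_ : j ≤ k + 1) (g : ℕ → ℝ),
    ∑ P ∈ s.powersetCard (k + 1), g (segmentSet s P j).card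
      = ∑ m ∈ Finset.range s.card, ((s.card - 1 - m).choose k : ℝ) * g m := by
  induction s using Finset.induction_on_max with
  | empty => intro k j _ g; rw [Finset.powersetCard_eq_empty.mpr (by simp)]; simp
  | insert x s hx ih =>
    intro k j hj g
    have hxs : x ∉ s := fun h => lt_irrefl _ (hx x h)
    rw [sum_powersetCard_insert hxs, Finset.card_insert_of_notMem hxs, Nat.add_sub_cancel]
    have h1 : ∀ P ∈ s.powersetCard k, g (segmentSet (insert x s) (insert x P) j).card
        = g (segmentSet s P j).card := by
      intro P hP
      rw [segmentSet_insert_insert hx]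
    rw [Finset.sum_congr rfl h1]
    -- If `j ≤ k`, the new maximum `x` never enters the `j`-th gap: as a non-pivot it falls into the
    -- last gap, as a pivot it leaves `k` pivots in `s`. The two counts add up by Pascal's rule.
    rcases Nat.lt_or_ge j (k + 1) with hjk | hjk
    · have h2 : ∀ P ∈ s.powersetCard (k + 1), g (segmentSet (insert x s) P j).card
          = g (segmentSet s P j).card := by
        intro P hP
        obtain ⟨hP1, hP2⟩ := Finset.mem_powersetCard.mp hP
        rw [segmentSet_insert hx hP1, if_neg (by omega)]
      rw [Finset.sum_congr rfl h2, ih k j (by omega), Finset.sum_range_succ]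
      cases k with
      | zero =>
        obtain rfl : j = 0 := by omega
        simp [segmentSet]
      | succ k =>
        rw [ih k j (by omega), ← Finset.sum_add_distrib, Nat.sub_self, Nat.choose_zero_succ]
        simp only [Nat.cast_zero, zero_mul, add_zero]
        refine Finset.sum_congr rfl fun m hm => ?_
        rw [Finset.mem_range] at hm
        obtain ⟨d, hd⟩ : ∃ d, s.card - m = d + 1 := ⟨s.card - m - 1, by omega⟩
        rw [hd, show s.card - 1 - m = d by omega, Nat.choose_succ_succ]
        push_cast
        ring
    -- In the last gap, `x` adds one element if it is not a pivot and leaves the gap empty if it is;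
    -- this is the split of the sum into `m + 1` and `0`.
    · obtain rfl : j = k + 1 := by omega
      have h2 : ∀ P ∈ s.powersetCard (k + 1), g (segmentSet (insert x s) P (k + 1)).card
          = g ((segmentSet s P (k + 1)).card + 1) := by
        intro P hP
        obtain ⟨hP1, hP2⟩ := Finset.mem_powersetCard.mp hP
        rw [segmentSet_insert hx hP1, if_pos hP2, Finset.card_insert_of_notMem]
        intro h
        exact hxs (Finset.mem_sdiff.mp (Finset.mem_filter.mp h).1).1
      have h3 : ∀ P ∈ s.powersetCard k, g (segmentSet s P (k + 1)).card = g 0 := by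
        intro P hP
        obtain ⟨hP1, hP2⟩ := Finset.mem_powersetCard.mp hP
        rw [segmentSet_eq_empty (by omega), Finset.card_empty]
      rw [Finset.sum_congr rfl h2, Finset.sum_congr rfl h3,
        ih k (k + 1) le_rfl (fun m => g (m + 1)), Finset.sum_range_succ', Finset.sum_const,
        Finset.card_powersetCard, nsmul_eq_mul, Nat.sub_zero]
      congr 1
      refine Finset.sum_congr rfl fun m _ => ?_
      rw [show s.card - (m + 1) = s.card - 1 - m by omega]

/-! ### The recurrence for the expected cost. -/

theorem average_add (s : Finset ℕ) (F G : List ℕ → ℝ) :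
    average s (fun l => F l + G l) = average s F + average s G := by
  simp only [average, Finset.sum_add_distrib, add_div]

theorem average_sum (s : Finset ℕ) {ι : Type*} (t : Finset ι) (F : ι → List ℕ → ℝ) :
    average s (fun l => ∑ j ∈ t, F j l) = ∑ j ∈ t, average s (F j) := by
  simp only [average, Finset.sum_div]
  exact Finset.sum_comm

theorem average_cost_of_lt {k : ℕ} (τ : List ℕ → ℝ) {s : Finset ℕ} (h : s.card < k) :
    average s (cost k τ) = 0 := by
  rw [average, Finset.sum_eq_zero, zero_div]
  intro l hl
  rw [cost, dif_neg]
  rw [length_of_mem_orderings hl]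
  omega

/-- The size function `E` stays abstract because the fact that the average depends on the size alone
is itself deduced from this identity, by strong induction. The factor `k + 2` is the number of
segments for `k + 1` pivots. -/
theorem average_cost_of_le {k : ℕ} {τ : List ℕ → ℝ} {a b : ℝ} (hτ : HasAverageToll (k + 1) τ a b)
    {s : Finset ℕ} (h : k + 1 ≤ s.card) (E : ℕ → ℝ)
    (hE : ∀ t : Finset ℕ, t.card < s.card → average t (cost (k + 1) τ) = E t.card) :
    (s.card.choose (k + 1) : ℝ) * average s (cost (k + 1) τ)
      = s.card.choose (k + 1) * (a * s.card + b)
        + (k + 2) * ∑ m ∈ Finset.range s.card, ((s.card - 1 - m).choose k : ℝ) * E m := by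
  have h1 : average s (cost (k + 1) τ) = average s (fun l => τ l
      + ∑ j ∈ Finset.range (k + 2), cost (k + 1) τ (segment (k + 1) l j)) := by
    refine average_congr fun l hl => ?_
    rw [cost, dif_pos]
    exact ⟨Nat.succ_pos _, by rw [length_of_mem_orderings hl]; exact h⟩
  rw [h1, average_add, average_sum, hτ s h, mul_add, Finset.mul_sum]
  congr 1
  have h2 : ∀ j ∈ Finset.range (k + 2), (s.card.choose (k + 1) : ℝ)
      * average s (fun l => cost (k + 1) τ (segment (k + 1) l j))
      = ∑ m ∈ Finset.range s.card, ((s.card - 1 - m).choose k : ℝ) * E m := by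
    intro j hj
    rw [Finset.mem_range] at hj
    rw [average_segment h, ← sum_card_segmentSet s k j (by omega)]
    refine Finset.sum_congr rfl fun P hP => hE _ ?_
    obtain ⟨hP1, hP2⟩ := Finset.mem_powersetCard.mp hP
    have := segmentSet_card_le s P j hP1
    omega
  rw [Finset.sum_congr rfl h2, Finset.sum_const, Finset.card_range, nsmul_eq_mul]
  push_cast
  ring

/-- The average cost depends only on the number of keys. -/
theorem average_cost_eq_expectedCost {k : ℕ} {τ : List ℕ → ℝ} {a b : ℝ}
    (hτ : HasAverageToll (k + 1) τ a b) (s : Finset ℕ) :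
    average s (cost (k + 1) τ) = expectedCost (k + 1) τ s.card := by
  induction hn : s.card using Nat.strong_induction_on generalizing s with
  | _ n ih =>
    have hE : ∀ t : Finset ℕ, t.card < n →
        average t (cost (k + 1) τ) = expectedCost (k + 1) τ t.card := fun t ht => ih _ ht t rfl
    have hc : (Finset.Icc 1 n).card = n := by simp
    subst hn
    rcases Nat.lt_or_ge s.card (k + 1) with h | h
    · rw [average_cost_of_lt τ h, expectedCost, average_cost_of_lt τ (by rwa [hc])]
    · have h1 := average_cost_of_le hτ h (expectedCost (k + 1) τ) hE
      have h2 := average_cost_of_le (s := Finset.Icc 1 s.card) hτ (by rwa [hc])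
        (expectedCost (k + 1) τ) (by rwa [hc])
      rw [hc, ← h1] at h2
      have h3 : (s.card.choose (k + 1) : ℝ) ≠ 0 := by
        exact_mod_cast (Nat.choose_pos h).ne'
      exact (mul_left_cancel₀ h3 h2).symm

theorem expectedCost_of_lt {k : ℕ} (τ : List ℕ → ℝ) {n : ℕ} (h : n < k) :
    expectedCost k τ n = 0 :=
  average_cost_of_lt τ (by simpa using h)

theorem expectedCost_recurrence {k : ℕ} {τ : List ℕ → ℝ} {a b : ℝ}
    (hτ : HasAverageToll (k + 1) τ a b) {n : ℕ} (h : k + 1 ≤ n) :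
    (n.choose (k + 1) : ℝ) * expectedCost (k + 1) τ n
      = n.choose (k + 1) * (a * n + b)
        + (k + 2) * ∑ m ∈ Finset.range n, ((n - 1 - m).choose k : ℝ) * expectedCost (k + 1) τ m := by
  have hc : (Finset.Icc 1 n).card = n := by simp
  have h2 := average_cost_of_le (s := Finset.Icc 1 n) hτ (by rwa [hc])
    (expectedCost (k + 1) τ) (fun t _ => average_cost_eq_expectedCost hτ t)
  rwa [hc] at h2

theorem sum_Icc_choose_eq_sum_range {k n : ℕ} (h : k + 1 ≤ n) (f : ℕ → ℝ) :
    ∑ i ∈ Finset.Icc 1 (n - (k + 1) + 1), ((n - i).choose k : ℝ) * f (i - 1)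
      = ∑ m ∈ Finset.range n, ((n - 1 - m).choose k : ℝ) * f m := by
  rw [← Finset.sum_subset (Finset.range_mono (by omega : n - (k + 1) + 1 ≤ n)),
    Finset.sum_range, ← Finset.sum_range (fun m => ((n - 1 - m).choose k : ℝ) * f m),
    Finset.range_eq_Ico, Finset.sum_Ico_eq_sum_range, ← Finset.Ico_add_one_right_eq_Icc,
    Finset.sum_Ico_eq_sum_range]
  · refine Finset.sum_congr (by congr 1) fun m _ => ?_
    rw [show n - (1 + m) = n - 1 - (0 + m) by omega, show 1 + m - 1 = 0 + m by omega]
  · intro m hm hm'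
    rw [Finset.mem_range] at hm hm'
    rw [Nat.choose_eq_zero_of_lt (by omega)]
    simp


/-! ### Solving the recurrence on coefficients. -/

theorem H_succ (n : ℕ) : H (n + 1) = H n + 1 / (n + 1) := by
  rw [H, H, harmonic_succ]; push_cast; rw [one_div]

theorem H_zero : H 0 = 0 := by simp [H]

theorem H_one : H 1 = 1 := by rw [H_succ, H_zero]; norm_num

theorem one_lt_H {k : ℕ} (hk : 1 ≤ k) : 1 < H (k + 1) := by
  induction k, hk using Nat.le_induction with
  | base => rw [H_succ, H_one]; norm_num
  | succ n _ ih => rw [H_succ]; have : (0 : ℝ) < 1 / ((n + 1 : ℕ) + 1) := by positivity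
                   linarith

theorem sum_choose_mul_succ {R : Type*} [CommRing R] (f : ℕ → R) (n k : ℕ) :
    ∑ m ∈ Finset.range (n + 1), ((n - m).choose (k + 1) : R) * f m
      = ∑ m ∈ Finset.range n, ((n - 1 - m).choose (k + 1) : R) * f m
        + ∑ m ∈ Finset.range n, ((n - 1 - m).choose k : R) * f m := by
  rw [Finset.sum_range_succ, Nat.sub_self, Nat.choose_zero_succ, Nat.cast_zero, zero_mul, add_zero,
    ← Finset.sum_add_distrib]
  refine Finset.sum_congr rfl fun m hm => ?_
  rw [Finset.mem_range] at hm
  obtain ⟨d, hd⟩ : ∃ d, n - m = d + 1 := ⟨n - m - 1, by omega⟩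
  rw [hd, show n - 1 - m = d by omega, Nat.choose_succ_succ]
  push_cast
  ring

theorem sum_choose_const (n k : ℕ) :
    ∑ m ∈ Finset.range n, ((n - 1 - m).choose k : ℝ) = n.choose (k + 1) := by
  rw [Finset.sum_range_reflect (fun j => (j.choose k : ℝ))]
  induction n with
  | zero => simp
  | succ n ih => rw [Finset.sum_range_succ, ih, Nat.choose_succ_succ n k]; push_cast; ring

/-- This is Pascal's rule for the products `C(N, K) (H_N - H_K)`. The increments of the two harmonic
numbers cancel because `N C(N - 1, K - 1) = K C(N, K)`. -/
theorem choose_mul_harmonic_step (n k : ℕ) :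
    ((n + 2).choose (k + 2) : ℝ) * (H (n + 2) - H (k + 2))
      = (n + 1).choose (k + 2) * (H (n + 1) - H (k + 2))
        + (n + 1).choose (k + 1) * (H (n + 1) - H (k + 1)) := by
  have h1 : ((n + 2).choose (k + 2) : ℝ) = (n + 1).choose (k + 1) + (n + 1).choose (k + 2) := by
    rw [Nat.choose_succ_succ]; push_cast; ring
  have h2 : ((n + 2 : ℕ) : ℝ) * (n + 1).choose (k + 1) = (n + 2).choose (k + 2) * ((k + 2 : ℕ) : ℝ) := by
    exact_mod_cast Nat.add_one_mul_choose_eq (n + 1) (k + 1)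
  rw [h1] at h2
  rw [h1, H_succ (n + 1), H_succ (k + 1)]
  push_cast at h2 ⊢
  field_simp
  linear_combination (-1 : ℝ) * h2

theorem sum_choose_mul_harmonic (n k : ℕ) :
    ∑ m ∈ Finset.range n, ((n - 1 - m).choose k : ℝ) * ((m + 1) * H m - m)
      = (n + 1).choose (k + 2) * (H (n + 1) - H (k + 2)) := by
  -- The summand is the column `K = 1` of the harmonic Pascal triangle; convolution with `C(·, k)`
  -- moves it to the column `k + 2`.
  have hf : ∀ m : ℕ, ((m + 1) * H m - m : ℝ) = (m + 1).choose 1 * (H (m + 1) - H 1) := by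
    intro m
    rw [H_one, H_succ, Nat.choose_one_right]
    push_cast
    field_simp
    ring
  induction n generalizing k with
  | zero => simp [Nat.choose_eq_zero_of_lt (show 1 < k + 2 by omega)]
  | succ n ih =>
    rw [Nat.add_sub_cancel, choose_mul_harmonic_step]
    cases k with
    | zero =>
      have h := ih 0
      simp only [Nat.choose_zero_right, Nat.cast_one, one_mul] at h ⊢
      rw [Finset.sum_range_succ, h, hf]
    | succ k => rw [sum_choose_mul_succ, ih, ih]

/-- The coefficient of `x ^ n` in `(1 - x) ^ r`. -/
noncomputable def binomCoeff (r : ℂ) (n : ℕ) : ℂ := (-1) ^ n * Ring.choose r n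

theorem factorial_mul_choose (r : ℂ) (n : ℕ) :
    (n ! : ℂ) * Ring.choose r n = (descPochhammer ℂ n).eval r := by
  have h := Ring.descPochhammer_eq_factorial_smul_choose r n
  rw [nsmul_eq_mul] at h
  rw [← h, ← descPochhammer_map (algebraMap ℤ ℂ), Polynomial.eval_map_algebraMap,
    Polynomial.aeval_eq_smeval]

theorem binomCoeff_neg (k d : ℕ) : binomCoeff (-((k : ℂ) + 1)) d = (d + k).choose k := by
  rw [binomCoeff, Ring.choose_neg', Ring.multichoose_eq]
  have h : ((k : ℂ) + 1 + d - 1) = ((d + k : ℕ) : ℂ) := by push_cast; ring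
  rw [h, Ring.choose_natCast, Int.negOnePow_def, Units.smul_def, ← Nat.choose_symm_add]
  simp [← mul_assoc, ← mul_pow]

/-- Chu–Vandermonde: these are the coefficients of `(1 - x) ^ (-(k + 1)) * (1 - x) ^ r`. -/
theorem sum_choose_mul_binomCoeff (r : ℂ) (k N : ℕ) :
    ∑ m ∈ Finset.range (N + 1), ((N - m + k).choose k : ℂ) * binomCoeff r m
      = binomCoeff (r - (k + 1)) N := by
  rw [binomCoeff, sub_eq_add_neg, Ring.add_choose_eq N (Commute.all r _),
    Finset.Nat.sum_antidiagonal_eq_sum_range_succ_mk, Finset.mul_sum]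
  refine Finset.sum_congr rfl fun m hm => ?_
  have hm' : m ≤ N := by rw [Finset.mem_range] at hm; omega
  rw [← binomCoeff_neg, binomCoeff, binomCoeff]
  have : (-1 : ℂ) ^ N = (-1) ^ (N - m) * (-1) ^ m := by rw [← pow_add, Nat.sub_add_cancel hm']
  rw [this]
  ring

/-- The coefficient form of differentiating `(1 - x) ^ r` `k` times and dividing by `k!`. -/
theorem choose_mul_binomCoeff (r : ℂ) {k n : ℕ} (h : k ≤ n) :
    (n.choose k : ℂ) * binomCoeff r n = binomCoeff r k * binomCoeff (r - k) (n - k) := by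
  have h1 := Ring.choose_smul_choose r h
  rw [nsmul_eq_mul] at h1
  rw [binomCoeff, binomCoeff, binomCoeff, mul_left_comm, h1]
  have : (-1 : ℂ) ^ n = (-1) ^ (n - k) * (-1) ^ k := by rw [← pow_add, Nat.sub_add_cancel h]
  rw [this]
  ring

theorem sum_range_choose_eq {R : Type*} [CommRing R] {k n : ℕ} (h : k + 1 ≤ n) (f : ℕ → R) :
    ∑ m ∈ Finset.range n, ((n - 1 - m).choose k : R) * f m
      = ∑ m ∈ Finset.range (n - (k + 1) + 1), ((n - (k + 1) - m + k).choose k : R) * f m := by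
  rw [← Finset.sum_subset (Finset.range_mono (by omega : n - (k + 1) + 1 ≤ n))]
  · refine Finset.sum_congr rfl fun m hm => ?_
    rw [Finset.mem_range] at hm
    rw [show n - (k + 1) - m + k = n - 1 - m by omega]
  · intro m hm hm'
    rw [Finset.mem_range] at hm hm'
    rw [Nat.choose_eq_zero_of_lt (by omega)]
    simp

theorem isRoot_indicialPoly_iff (k : ℕ) (r : ℂ) :
    (indicialPoly k).IsRoot r ↔ (-1 : ℂ) ^ k * (descPochhammer ℂ k).eval r = ((k + 1)! : ℕ) := by
  rw [Polynomial.IsRoot.def, indicialPoly, Polynomial.eval_sub, Polynomial.eval_mul,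
    Polynomial.eval_C, Polynomial.eval_C, sub_eq_zero]

theorem binomCoeff_of_isRoot {k : ℕ} {r : ℂ} (hr : (indicialPoly k).IsRoot r) :
    binomCoeff r k = k + 1 := by
  rw [isRoot_indicialPoly_iff, ← factorial_mul_choose, Nat.factorial_succ] at hr
  have h : (k ! : ℂ) ≠ 0 := by exact_mod_cast k.factorial_ne_zero
  apply mul_left_cancel₀ h
  rw [binomCoeff]
  push_cast at hr
  linear_combination hr

/-- Both sides are multiples of `binomCoeff (r - (k + 1)) (n - (k + 1))`, by `binomCoeff r (k + 1)`
and by `k + 2`; the indicial equation, divided by `(k + 1)!`, equates the two multipliers. -/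
theorem binomCoeff_recurrence {k : ℕ} {r : ℂ} (hr : (indicialPoly (k + 1)).IsRoot r) {n : ℕ}
    (h : k + 1 ≤ n) : (n.choose (k + 1) : ℂ) * binomCoeff r n
      = (k + 2) * ∑ m ∈ Finset.range n, ((n - 1 - m).choose k : ℂ) * binomCoeff r m := by
  rw [choose_mul_binomCoeff r h, binomCoeff_of_isRoot hr, sum_range_choose_eq h,
    sum_choose_mul_binomCoeff]
  push_cast
  ring

/-- After division by the binomial coefficient, the harmonic part leaves the defect `A (n + 1)
(H_{k+2} - 1) = a (n + 1)`, and the constant leaves `-(k + 1)` times itself, that is `b - a`.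
Together they make `a n + b`. -/
theorem particular_recurrence (k : ℕ) (a b : ℝ) (n : ℕ) :
    (n.choose (k + 1) : ℝ) * (lead (k + 1) a * ((n + 1) * H n - n) + (a - b) / (k + 1))
      = n.choose (k + 1) * (a * n + b)
        + (k + 2) * ∑ m ∈ Finset.range n, ((n - 1 - m).choose k : ℝ)
            * (lead (k + 1) a * ((m + 1) * H m - m) + (a - b) / (k + 1)) := by
  have h1 : ∑ m ∈ Finset.range n, ((n - 1 - m).choose k : ℝ)
            * (lead (k + 1) a * ((m + 1) * H m - m) + (a - b) / (k + 1))
      = lead (k + 1) a * ((n + 1).choose (k + 2) * (H (n + 1) - H (k + 2)))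
        + (a - b) / (k + 1) * n.choose (k + 1) := by
    rw [← sum_choose_mul_harmonic, ← sum_choose_const, Finset.mul_sum, Finset.mul_sum,
      ← Finset.sum_add_distrib]
    refine Finset.sum_congr rfl fun m _ => ?_
    ring
  have h2 : ((n + 1 : ℕ) : ℝ) * n.choose (k + 1) = (n + 1).choose (k + 2) * ((k + 2 : ℕ) : ℝ) := by
    exact_mod_cast Nat.add_one_mul_choose_eq n (k + 1)
  have h3 : lead (k + 1) a * (H (k + 2) - 1) = a := by
    have := one_lt_H (k := k + 1) (by omega)
    rw [lead]
    field_simp [sub_ne_zero.mpr this.ne']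
  have h4 : (n + 1) * H (n + 1) = (n + 1) * H n + 1 := by
    rw [H_succ]; field_simp
  have h5 : (a - b) / (k + 1) * (k + 1) = a - b := by field_simp
  rw [h1]
  push_cast at h2
  set A := lead (k + 1) a
  set d := (a - b) / ((k : ℝ) + 1)
  linear_combination (A * (H (n + 1) - H (k + 2))) * h2 - (n.choose (k + 1) * A) * h4
    + (n.choose (k + 1) * (n + 1)) * h3 - (n.choose (k + 1) : ℝ) * h5

theorem recurrence_unique {k : ℕ} {u v g : ℕ → ℂ} (h0 : ∀ n < k + 1, u n = v n)
    (hu : ∀ n, k + 1 ≤ n → (n.choose (k + 1) : ℂ) * u n = g n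
      + (k + 2) * ∑ m ∈ Finset.range n, ((n - 1 - m).choose k : ℂ) * u m)
    (hv : ∀ n, k + 1 ≤ n → (n.choose (k + 1) : ℂ) * v n = g n
      + (k + 2) * ∑ m ∈ Finset.range n, ((n - 1 - m).choose k : ℂ) * v m) (n : ℕ) :
    u n = v n := by
  induction n using Nat.strong_induction_on with
  | _ n ih =>
    rcases Nat.lt_or_ge n (k + 1) with h | h
    · exact h0 n h
    · have h3 : (n.choose (k + 1) : ℂ) ≠ 0 := by
        exact_mod_cast (Nat.choose_pos h).ne'
      apply mul_left_cancel₀ h3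
      rw [hu n h, hv n h]
      congr 2
      refine Finset.sum_congr rfl fun m hm => ?_
      rw [ih m (Finset.mem_range.mp hm)]

/-- Closed form of the expected cost. -/
theorem expectedCost_eq {k : ℕ} {τ : List ℕ → ℝ} {a b : ℝ} (hτ : HasAverageToll (k + 1) τ a b)
    {r s : Fin (k + 1) → ℂ} (hr : ∀ i, (indicialPoly (k + 1)).IsRoot (r i))
    (hs : IsIntegrationConstants (k + 1) a b r s) (n : ℕ) :
    (expectedCost (k + 1) τ n : ℂ)
      = (lead (k + 1) a * ((n + 1) * H n - n) + (a - b) / (k + 1) : ℝ)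
        + ∑ i, s i * binomCoeff (r i) n := by
  refine recurrence_unique (k := k) (u := fun n => (expectedCost (k + 1) τ n : ℂ))
    (v := fun n => ((lead (k + 1) a * ((n + 1) * H n - n) + (a - b) / (k + 1) : ℝ) : ℂ)
        + ∑ i, s i * binomCoeff (r i) n)
    (g := fun n => ((n.choose (k + 1) * (a * n + b) : ℝ) : ℂ)) ?_ ?_ ?_ n
  -- Row `m` of the linear system says that the closed form vanishes at `n = m`, up to the factor
  -- `(-1) ^ m * m!`.
  · intro m hm
    have h := hs ⟨m, hm⟩
    simp only [← factorial_mul_choose] at h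
    have h1 : ∑ i, s i * binomCoeff (r i) m
        = (-1) ^ m * (m ! : ℂ)⁻¹ * ∑ i, s i * (m ! * Ring.choose (r i) m) := by
      have : (m ! : ℂ) ≠ 0 := by exact_mod_cast m.factorial_ne_zero
      rw [Finset.mul_sum]
      refine Finset.sum_congr rfl fun i _ => ?_
      rw [binomCoeff]
      field_simp
    simp only [expectedCost_of_lt τ hm, h1, h, sysRHS]
    have : (m ! : ℂ) ≠ 0 := by exact_mod_cast m.factorial_ne_zero
    have h2 : (-1 : ℂ) ^ m * (-1) ^ (m + 1) = -1 := by
      rw [pow_succ, ← mul_assoc, ← mul_pow]; simp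
    push_cast
    field_simp
    linear_combination (-1 : ℂ) * ((lead (k + 1) a * ((m + 1) * H m - m)) * (k + 1) + (a - b)) * h2
  · intro n hn
    have := congrArg (fun x : ℝ => (x : ℂ)) (expectedCost_recurrence hτ hn)
    simpa using this
  · intro n hn
    have h1 := congrArg (fun x : ℝ => (x : ℂ)) (particular_recurrence k a b n)
    have h2 : (n.choose (k + 1) : ℂ) * ∑ i, s i * binomCoeff (r i) n
        = (k + 2) * ∑ m ∈ Finset.range n, ((n - 1 - m).choose k : ℂ)
          * ∑ i, s i * binomCoeff (r i) m := by
      simp only [Finset.mul_sum]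
      rw [Finset.sum_comm]
      refine Finset.sum_congr rfl fun i _ => ?_
      rw [mul_left_comm, binomCoeff_recurrence (hr i) hn, Finset.mul_sum, Finset.mul_sum]
      refine Finset.sum_congr rfl fun m _ => ?_
      ring
    simp only [mul_add, Finset.sum_add_distrib, h2]
    simp only [Complex.ofReal_mul, Complex.ofReal_add, Complex.ofReal_sum, Complex.ofReal_natCast,
      mul_add, Finset.sum_add_distrib] at h1 ⊢
    rw [h1]
    push_cast
    ring

open Polynomial

/-! ### Roots of the indicial polynomial. -/

theorem neg_one_pow_mul_descPochhammer_eval (k : ℕ) (z : ℂ) :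
    (-1 : ℂ) ^ k * (descPochhammer ℂ k).eval z = ∏ j ∈ Finset.range k, ((j : ℂ) - z) := by
  induction k with
  | zero => simp
  | succ k ih =>
    rw [Finset.prod_range_succ, ← ih, descPochhammer_succ_eval]
    ring

theorem neg_one_pow_mul_descPochhammer (k : ℕ) :
    C ((-1 : ℂ) ^ k) * descPochhammer ℂ k = ∏ j ∈ Finset.range k, (C (j : ℂ) - X) := by
  refine Polynomial.funext fun z => ?_
  rw [eval_mul, eval_C, neg_one_pow_mul_descPochhammer_eval, eval_prod]
  simp

theorem isRoot_iff_prod (k : ℕ) (z : ℂ) :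
    (indicialPoly k).IsRoot z ↔ ∏ j ∈ Finset.range k, ((j : ℂ) - z) = ((k + 1)! : ℕ) := by
  rw [isRoot_indicialPoly_iff, neg_one_pow_mul_descPochhammer_eval]

theorem isRoot_ofReal_iff (k : ℕ) (x : ℝ) :
    (indicialPoly k).IsRoot (x : ℂ) ↔ ∏ j ∈ Finset.range k, ((j : ℝ) - x) = ((k + 1)! : ℕ) := by
  rw [isRoot_iff_prod, ← Complex.ofReal_inj]
  push_cast
  rfl

theorem isRoot_conj {k : ℕ} {z : ℂ} (h : (indicialPoly k).IsRoot z) :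
    (indicialPoly k).IsRoot (starRingEnd ℂ z) := by
  rw [isRoot_iff_prod] at h ⊢
  have := congrArg (starRingEnd ℂ) h
  simpa [map_prod] using this

theorem prod_range_add_two (k : ℕ) : ∏ j ∈ Finset.range k, ((j : ℝ) + 2) = ((k + 1)! : ℕ) := by
  induction k with
  | zero => simp
  | succ k ih => rw [Finset.prod_range_succ, ih, Nat.factorial_succ (k + 1)]; push_cast; ring

theorem prod_range_sub (k : ℕ) :
    ∏ j ∈ Finset.range k, ((k : ℝ) + 1 - j) = ((k + 1)! : ℕ) := by
  rw [← prod_range_add_two, ← Finset.prod_range_reflect]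
  refine Finset.prod_congr rfl fun j hj => ?_
  rw [Finset.mem_range] at hj
  rw [show k - 1 - j = k - (j + 1) by omega, Nat.cast_sub (by omega)]
  push_cast
  ring

/-- Excludes real roots in `[-1, k]`, since `k! < (k + 1)!`. The last factor is split off until `x`
lies in the top unit interval, where the factors are bounded by the integers of the factorial in
reverse order. -/
theorem prod_range_abs_sub_le (k : ℕ) {x : ℝ} (h1 : -1 ≤ x) (h2 : x ≤ k) :
    ∏ j ∈ Finset.range k, |(j : ℝ) - x| ≤ (k ! : ℕ) := by
  induction k with
  | zero => simp
  | succ k ih =>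
    rcases le_total x k with h | h
    · rw [Finset.prod_range_succ, Nat.factorial_succ, mul_comm (k + 1)]
      push_cast
      refine mul_le_mul (ih h) ?_ (abs_nonneg _) (by positivity)
      rw [abs_le]; constructor <;> linarith
    · rw [← Finset.prod_range_add_one_eq_factorial, ← Finset.prod_range_reflect, Nat.cast_prod]
      refine Finset.prod_le_prod (fun _ _ => abs_nonneg _) fun j hj => ?_
      rw [Finset.mem_range] at hj
      rw [show k + 1 - 1 - j = k - j by omega, Nat.cast_sub (by omega)]
      push_cast at h2 ⊢
      have : (j : ℝ) ≤ k := by exact_mod_cast (by omega : j ≤ k)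
      rw [abs_le]; constructor <;> linarith

theorem prod_range_sub_comm (k : ℕ) (x : ℝ) :
    ∏ j ∈ Finset.range k, ((j : ℝ) - x) = (-1) ^ k * ∏ j ∈ Finset.range k, (x - j) := by
  induction k with
  | zero => simp
  | succ k ih => rw [Finset.prod_range_succ, Finset.prod_range_succ, ih]; ring

theorem prod_range_lt_prod_range {k : ℕ} (hk : 1 ≤ k) {f g : ℕ → ℝ} (hf : ∀ j < k, 0 < f j)
    (hfg : ∀ j < k, f j < g j) : ∏ j ∈ Finset.range k, f j < ∏ j ∈ Finset.range k, g j := by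
  refine Finset.prod_lt_prod (fun j hj => hf j (Finset.mem_range.mp hj))
    (fun j hj => (hfg j (Finset.mem_range.mp hj)).le) ⟨0, ?_, hfg 0 hk⟩
  exact Finset.mem_range.mpr hk

theorem isRoot_neg_two (k : ℕ) : (indicialPoly k).IsRoot (-2) := by
  have h := (isRoot_ofReal_iff k (-2)).mpr (by rw [← prod_range_add_two]; simp)
  simpa using h

theorem isRoot_succ {k : ℕ} (hk : Even k) : (indicialPoly k).IsRoot ((k : ℂ) + 1) := by
  have h := (isRoot_ofReal_iff k (k + 1)).mpr (by
    rw [← prod_range_sub, prod_range_sub_comm, hk.neg_one_pow, one_mul])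
  simpa using h

/-- Left of `-1` all factors `j - x` are positive and decreasing in `x`, so the value `(k + 1)!` is
taken only at `-2`. Right of `k` the same monotonicity holds for `x - j`, with equality at `k + 1`,
and the sign `(-1) ^ k` requires `k` to be even. In between the product is too small. -/
theorem real_root {k : ℕ} (hk : 1 ≤ k) {x : ℝ} (h : (indicialPoly k).IsRoot (x : ℂ)) :
    x = -2 ∨ (Even k ∧ x = k + 1) := by
  rw [isRoot_ofReal_iff] at h
  rcases lt_or_ge x (-1) with h1 | h1
  · left
    rw [← prod_range_add_two] at h
    rcases lt_trichotomy x (-2) with h2 | h2 | h2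
    · exfalso
      refine (prod_range_lt_prod_range hk ?_ ?_).ne' h
      · intro j _; positivity
      · intro j _; linarith
    · exact h2
    · exfalso
      refine (prod_range_lt_prod_range hk ?_ ?_).ne h
      · intro j _
        have : (0 : ℝ) ≤ j := by positivity
        linarith
      · intro j _; linarith
  rcases le_or_gt x k with h2 | h2
  · exfalso
    have h3 := prod_range_abs_sub_le k h1 h2
    rw [← Finset.abs_prod, h, Nat.abs_cast] at h3
    have : k ! < (k + 1)! := Nat.factorial_lt_of_lt hk (Nat.lt_succ_self k)
    exact absurd h3 (not_le.mpr (by exact_mod_cast this))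
  · right
    rw [prod_range_sub_comm] at h
    have hpos : ∀ j < k, (0 : ℝ) < x - j := by
      intro j hj
      have : (j : ℝ) < k := by exact_mod_cast hj
      linarith
    have hp : 0 < ∏ j ∈ Finset.range k, (x - (j : ℝ)) :=
      Finset.prod_pos fun j hj => hpos j (Finset.mem_range.mp hj)
    rcases Nat.even_or_odd k with he | ho
    · refine ⟨he, ?_⟩
      rw [he.neg_one_pow, one_mul, ← prod_range_sub] at h
      rcases lt_trichotomy x (k + 1) with h3 | h3 | h3
      · exfalso
        refine (prod_range_lt_prod_range hk hpos ?_).ne h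
        intro j _; linarith
      · exact h3
      · exfalso
        refine (prod_range_lt_prod_range hk ?_ ?_).ne' h
        · intro j hj
          have : (j : ℝ) < k := by exact_mod_cast hj
          linarith
        · intro j _; linarith
    · exfalso
      rw [ho.neg_one_pow] at h
      have : (0 : ℝ) ≤ ((k + 1)! : ℕ) := by positivity
      linarith

theorem norm_prod_of_isRoot {k : ℕ} {z : ℂ} (h : (indicialPoly k).IsRoot z) :
    ∏ j ∈ Finset.range k, ‖(j : ℂ) - z‖ = ((k + 1)! : ℕ) := by
  rw [isRoot_iff_prod] at h
  rw [← norm_prod, h, Complex.norm_natCast]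

/-- If `z.re ≤ -2` and `z ≠ -2`, every factor satisfies `‖j - z‖ > j + 2`, and the product of the
norms exceeds `(k + 1)!`. On the line `z.re = -2` the strictness comes from the imaginary part. -/
theorem neg_two_lt_re {k : ℕ} (hk : 1 ≤ k) {z : ℂ} (h : (indicialPoly k).IsRoot z) (hz : z ≠ -2) :
    -2 < z.re := by
  by_contra! h1
  have h2 := norm_prod_of_isRoot h
  rw [← prod_range_add_two] at h2
  refine (prod_range_lt_prod_range hk ?_ ?_).ne' h2
  · intro j _; positivity
  · intro j _
    have h3 : (j : ℝ) + 2 ≤ |((j : ℂ) - z).re| := by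
      refine le_trans ?_ (le_abs_self _)
      simp; linarith
    rcases h1.lt_or_eq with h4 | h4
    · refine lt_of_lt_of_le ?_ ((le_abs_self _).trans (Complex.abs_re_le_norm _))
      simp; linarith
    · refine lt_of_le_of_lt h3 (Complex.abs_re_lt_norm.mpr ?_)
      intro h5
      apply hz
      apply Complex.ext
      · simpa using h4
      · simpa using h5

theorem re_le_succ {k : ℕ} (hk : 1 ≤ k) {z : ℂ} (h : (indicialPoly k).IsRoot z) :
    z.re ≤ k + 1 := by
  by_contra! h1
  have h2 := norm_prod_of_isRoot h
  rw [← prod_range_sub] at h2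
  refine (prod_range_lt_prod_range hk ?_ ?_).ne' h2
  · intro j hj
    have : (j : ℝ) < k := by exact_mod_cast hj
    linarith
  · intro j _
    refine lt_of_lt_of_le ?_ ((neg_le_abs _).trans (Complex.abs_re_le_norm _))
    simp; linarith

theorem sub_ne_zero_of_isRoot {k : ℕ} {z : ℂ} (h : (indicialPoly k).IsRoot z) :
    ∀ j ∈ Finset.range k, (j : ℂ) - z ≠ 0 := by
  rw [isRoot_iff_prod] at h
  rw [← Finset.prod_ne_zero_iff, h]
  exact_mod_cast (Nat.factorial_ne_zero _)

/-- Logarithmic differentiation of `∏ (j - z)`, which equals `(k + 1)!` at a root. -/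
theorem derivative_indicialPoly_eval {k : ℕ} {z : ℂ} (h : (indicialPoly k).IsRoot z) :
    (derivative (indicialPoly k)).eval z
      = -((k + 1)! : ℕ) * ∑ j ∈ Finset.range k, 1 / ((j : ℂ) - z) := by
  have h0 := sub_ne_zero_of_isRoot h
  rw [isRoot_iff_prod] at h
  rw [indicialPoly, neg_one_pow_mul_descPochhammer, derivative_sub, derivative_C, sub_zero,
    derivative_prod_finset, eval_finsetSum, ← h, Finset.mul_sum]
  refine Finset.sum_congr rfl fun i hi => ?_
  rw [eval_mul, eval_prod, ← Finset.mul_prod_erase _ _ hi]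
  have := h0 i hi
  simp
  field_simp

/-- The imaginary part of `∑ 1 / (j - z)` is `z.im` times a positive number, so a zero of the sum is
real. At the possible real roots `-2` and `k + 1` all terms have the same sign. -/
theorem derivative_indicialPoly_ne_zero {k : ℕ} (hk : 1 ≤ k) {z : ℂ}
    (h : (indicialPoly k).IsRoot z) : (derivative (indicialPoly k)).eval z ≠ 0 := by
  have h0 := sub_ne_zero_of_isRoot h
  have hne : (Finset.range k).Nonempty := ⟨0, Finset.mem_range.mpr hk⟩
  rw [derivative_indicialPoly_eval h]
  refine mul_ne_zero (neg_ne_zero.mpr (by exact_mod_cast Nat.factorial_ne_zero _)) fun hs => ?_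
  have him : z.im = 0 := by
    have h1 := congrArg Complex.im hs
    have h2 : ∀ j ∈ Finset.range k, (1 / ((j : ℂ) - z)).im
        = z.im * (Complex.normSq ((j : ℂ) - z))⁻¹ := by
      intro j _
      rw [one_div, Complex.inv_im]
      simp [div_eq_mul_inv]
    rw [Complex.im_sum, Finset.sum_congr rfl h2, ← Finset.mul_sum, Complex.zero_im] at h1
    refine (mul_eq_zero.mp h1).resolve_right (ne_of_gt ?_)
    refine Finset.sum_pos (fun j hj => ?_) hne
    exact inv_pos.mpr (Complex.normSq_pos.mpr (h0 j hj))
  obtain ⟨x, rfl⟩ : ∃ x : ℝ, (x : ℂ) = z := ⟨z.re, Complex.ext rfl (by simp [him])⟩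
  have hs' : ∑ j ∈ Finset.range k, 1 / ((j : ℝ) - x) = 0 := by exact_mod_cast hs
  rcases real_root hk h with rfl | ⟨-, rfl⟩
  · refine (Finset.sum_pos (fun j _ => ?_) hne).ne' hs'
    rw [sub_neg_eq_add]
    positivity
  · refine (Finset.sum_neg (fun j hj => ?_) hne).ne hs'
    rw [Finset.mem_range] at hj
    have : (j : ℝ) < k := by exact_mod_cast hj
    exact one_div_neg.mpr (by linarith)

theorem natDegree_indicialPoly (k : ℕ) : (indicialPoly k).natDegree = k := by
  have h : (C ((-1 : ℂ) ^ k) * descPochhammer ℂ k).natDegree = k := by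
    rw [natDegree_C_mul (by simp), descPochhammer_natDegree]
  rw [indicialPoly, natDegree_sub_C, h]

theorem leadingCoeff_indicialPoly {k : ℕ} (hk : 1 ≤ k) :
    (indicialPoly k).leadingCoeff = (-1) ^ k := by
  have h : (C ((-1 : ℂ) ^ k) * descPochhammer ℂ k).natDegree = k := by
    rw [natDegree_C_mul (by simp), descPochhammer_natDegree]
  rw [indicialPoly, leadingCoeff_sub_of_degree_lt, leadingCoeff_mul, leadingCoeff_C,
    (monic_descPochhammer ℂ k).leadingCoeff, mul_one]
  refine degree_C_le.trans_lt ?_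
  rw [← natDegree_pos_iff_degree_pos, h]
  exact hk

theorem nodup_roots_indicialPoly {k : ℕ} (hk : 1 ≤ k) : (indicialPoly k).roots.Nodup := by
  have h0 : indicialPoly k ≠ 0 := by
    intro h
    have := natDegree_indicialPoly k
    rw [h, natDegree_zero] at this
    omega
  rw [Multiset.nodup_iff_count_le_one]
  intro z
  rw [count_roots]
  by_contra! h1
  have h2 := (one_lt_rootMultiplicity_iff_isRoot h0).mp h1
  exact derivative_indicialPoly_ne_zero hk h2.1 h2.2

theorem exists_roots {k : ℕ} (hk : 1 ≤ k) : ∃ r : Fin k → ℂ, Function.Injective r ∧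
    Set.range r = {z : ℂ | (indicialPoly k).IsRoot z} := by
  have h0 : indicialPoly k ≠ 0 := by
    intro h
    have := natDegree_indicialPoly k
    rw [h, natDegree_zero] at this
    omega
  have hc : (indicialPoly k).roots.toFinset.card = k := by
    rw [Multiset.toFinset_card_of_nodup (nodup_roots_indicialPoly hk),
      IsAlgClosed.card_roots_eq_natDegree, natDegree_indicialPoly]
  let e := Finset.equivFinOfCardEq hc
  refine ⟨fun i => (e.symm i : ℂ), fun i j h => e.symm.injective (Subtype.ext h), ?_⟩
  ext z
  simp only [Set.mem_range, Set.mem_ofPred_eq]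
  constructor
  · rintro ⟨i, rfl⟩
    have := (e.symm i).2
    rw [Multiset.mem_toFinset, mem_roots h0] at this
    exact this
  · intro h
    exact ⟨e ⟨z, by rwa [Multiset.mem_toFinset, mem_roots h0]⟩, by simp⟩

/-- Complex conjugation as a permutation of the indices of the roots. -/
theorem exists_conj_index {k : ℕ} {r : Fin k → ℂ} (hinj : Function.Injective r)
    (hr : Set.range r = {z : ℂ | (indicialPoly k).IsRoot z}) :
    ∃ σ : Equiv.Perm (Fin k), (∀ i, r (σ i) = starRingEnd ℂ (r i)) ∧ ∀ i, σ (σ i) = i := by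
  have h : ∀ i, ∃ j, r j = starRingEnd ℂ (r i) := by
    intro i
    have : r i ∈ Set.range r := ⟨i, rfl⟩
    rw [hr] at this
    have h2 : starRingEnd ℂ (r i) ∈ Set.range r := by rw [hr]; exact isRoot_conj this
    exact h2
  choose f hf using h
  have hff : Function.Involutive f := by
    intro i
    apply hinj
    rw [hf, hf, Complex.conj_conj]
  exact ⟨hff.toPerm, hf, hff⟩

/-- Conjugation pairs the roots in the upper and lower half planes, and two roots (`k` even) or one
(`k` odd) are real. -/
theorem card_pos_im {k : ℕ} (hk : 1 ≤ k) {r : Fin k → ℂ} (hinj : Function.Injective r)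
    (hr : Set.range r = {z : ℂ | (indicialPoly k).IsRoot z}) :
    (Finset.univ.filter (fun i => 0 < (r i).im)).card = (k - 1) / 2 := by
  obtain ⟨σ, hσ, hσσ⟩ := exists_conj_index hinj hr
  have hroot : ∀ i, (indicialPoly k).IsRoot (r i) := fun i => by
    have : r i ∈ Set.range r := ⟨i, rfl⟩
    rwa [hr] at this
  have h1 : (Finset.univ.filter (fun i => (r i).im < 0)).card
      = (Finset.univ.filter (fun i => 0 < (r i).im)).card := by
    refine Finset.card_nbij' σ σ ?_ ?_ (fun i _ => hσσ i) (fun i _ => hσσ i)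
    · intro i hi; simpa [hσ] using hi
    · intro i hi; simpa [hσ] using hi
  have hz : ∀ i, (r i).im = 0 → r i = -2 ∨ (Even k ∧ r i = k + 1) := by
    intro i hi
    have he : (((r i).re : ℝ) : ℂ) = r i := Complex.ext rfl (by simp [hi])
    have h2 := hroot i
    rw [← he] at h2
    rcases real_root hk h2 with h3 | ⟨h3, h4⟩
    · left; rw [← he, h3]; simp
    · right; refine ⟨h3, ?_⟩; rw [← he, h4]; simp
  have hex : ∀ z, (indicialPoly k).IsRoot z → ∃ i, r i = z := fun z h => by
    have : z ∈ Set.range r := by rw [hr]; exact h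
    exact this
  have h2 : (Finset.univ.filter (fun i => (r i).im = 0)).card = if Even k then 2 else 1 := by
    rw [← Finset.card_image_of_injective _ hinj]
    obtain ⟨i, hi⟩ := hex _ (isRoot_neg_two k)
    split_ifs with he
    · obtain ⟨j, hj⟩ := hex _ (isRoot_succ he)
      have : (Finset.univ.filter (fun i => (r i).im = 0)).image r = {-2, (k : ℂ) + 1} := by
        ext z
        simp only [Finset.mem_image, Finset.mem_filter, Finset.mem_univ, true_and,
          Finset.mem_insert, Finset.mem_singleton]
        constructor
        · rintro ⟨l, hl, rfl⟩
          rcases hz l hl with h | ⟨-, h⟩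
          · exact Or.inl h
          · exact Or.inr h
        · rintro (rfl | rfl)
          · exact ⟨i, by simp [hi], hi⟩
          · exact ⟨j, by simp [hj], hj⟩
      rw [this, Finset.card_pair]
      intro h
      have := congrArg Complex.re h
      simp at this
      have h3 : (0 : ℝ) ≤ k := by positivity
      linarith
    · have : (Finset.univ.filter (fun i => (r i).im = 0)).image r = {-2} := by
        ext z
        simp only [Finset.mem_image, Finset.mem_filter, Finset.mem_univ, true_and,
          Finset.mem_singleton]
        constructor
        · rintro ⟨l, hl, rfl⟩
          exact (hz l hl).resolve_right fun h => he h.1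
        · rintro rfl
          exact ⟨i, by simp [hi], hi⟩
      rw [this, Finset.card_singleton]
  have h3 : (Finset.univ.filter (fun i => 0 < (r i).im)).card
      + ((Finset.univ.filter (fun i => (r i).im = 0)).card
      + (Finset.univ.filter (fun i => (r i).im < 0)).card) = k := by
    have := Finset.card_filter_add_card_filter_not (s := (Finset.univ : Finset (Fin k)))
      (fun i => 0 < (r i).im)
    rw [Finset.card_univ, Fintype.card_fin] at this
    refine Eq.trans ?_ this
    congr 1
    rw [← Finset.card_union_of_disjoint, ← Finset.filter_or]
    · congr 1
      ext i
      simp only [Finset.mem_filter, Finset.mem_univ, true_and, not_lt, le_iff_eq_or_lt]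
    · rw [Finset.disjoint_filter]
      intro i _ h4 h5
      linarith
  rw [h1, h2] at h3
  split_ifs at h3 with he
  · obtain ⟨m, rfl⟩ := he
    omega
  · rw [Nat.not_even_iff_odd] at he
    obtain ⟨m, rfl⟩ := he
    omega


/-! ### The integration constants. -/

theorem pow_eq_sum_stirlingSecond (m : ℕ) (x : ℂ) :
    x ^ m = ∑ j ∈ Finset.range (m + 1), (Nat.stirlingSecond m j : ℂ) * (descPochhammer ℂ j).eval x := by
  induction m with
  | zero => simp
  | succ m ih =>
    have h1 : ∑ j ∈ Finset.range (m + 1),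
        ((j + 1) * Nat.stirlingSecond m (j + 1) : ℂ) * (descPochhammer ℂ (j + 1)).eval x
        = ∑ j ∈ Finset.range (m + 1), (j * Nat.stirlingSecond m j : ℂ) * (descPochhammer ℂ j).eval x := by
      have h2 := Finset.sum_range_succ'
        (fun j => (j * Nat.stirlingSecond m j : ℂ) * (descPochhammer ℂ j).eval x) (m + 1)
      rw [Finset.sum_range_succ, Nat.stirlingSecond_eq_zero_of_lt (Nat.lt_succ_self m)] at h2
      simpa using h2.symm
    rw [pow_succ, ih, Finset.sum_range_succ' _ (m + 1), Nat.stirlingSecond_succ_zero, Finset.sum_mul]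
    simp only [Nat.stirlingSecond_succ_succ, Nat.cast_add, Nat.cast_mul, Nat.cast_one, add_mul,
      Finset.sum_add_distrib] at h1 ⊢
    rw [h1, ← Finset.sum_add_distrib, Nat.cast_zero, zero_mul, add_zero]
    refine Finset.sum_congr rfl fun j _ => ?_
    rw [descPochhammer_succ_eval]
    ring

theorem vandermonde_transpose_mulVec {k : ℕ} (r s : Fin k → ℂ) (m : Fin k) :
    (Matrix.vandermonde r).transpose.mulVec s m = ∑ i, s i * r i ^ (m : ℕ) := by
  simp only [Matrix.mulVec, dotProduct, Matrix.transpose_apply, Matrix.vandermonde_apply]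
  exact Finset.sum_congr rfl fun i _ => mul_comm _ _

/-- The Stirling numbers pass from falling factorials to powers by a unitriangular matrix, so the
two systems are equivalent; the converse solves for one row after another. -/
theorem isIntegrationConstants_iff {k : ℕ} {a b : ℝ} (r s : Fin k → ℂ) :
    IsIntegrationConstants k a b r s ↔
      (Matrix.vandermonde r).transpose.mulVec s = fun m : Fin k =>
        ∑ j ∈ Finset.range ((m : ℕ) + 1), (Nat.stirlingSecond m j : ℂ) * (sysRHS k a b j : ℂ) := by
  have key : ∀ m : ℕ, ∑ i, s i * r i ^ m = ∑ j ∈ Finset.range (m + 1),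
      (Nat.stirlingSecond m j : ℂ) * ∑ i, s i * (descPochhammer ℂ j).eval (r i) := by
    intro m
    simp only [Finset.mul_sum]
    rw [Finset.sum_comm]
    refine Finset.sum_congr rfl fun i _ => ?_
    rw [pow_eq_sum_stirlingSecond, Finset.mul_sum]
    exact Finset.sum_congr rfl fun j _ => mul_left_comm _ _ _
  constructor
  · intro h
    funext m
    rw [vandermonde_transpose_mulVec, key]
    refine Finset.sum_congr rfl fun j hj => ?_
    rw [Finset.mem_range] at hj
    rw [h ⟨j, by omega⟩]
  · intro h
    have h' : ∀ m, (hm : m < k) →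
        ∑ i, s i * (descPochhammer ℂ m).eval (r i) = (sysRHS k a b m : ℂ) := by
      intro m
      induction m using Nat.strong_induction_on with
      | _ m ih =>
        intro hm
        have h1 := congrFun h ⟨m, hm⟩
        rw [vandermonde_transpose_mulVec, key, Finset.sum_range_succ, Finset.sum_range_succ,
          Nat.stirlingSecond_self, Nat.cast_one, one_mul, one_mul,
          Finset.sum_congr rfl fun j hj => by
            rw [ih j (Finset.mem_range.mp hj) ((Finset.mem_range.mp hj).trans hm)]] at h1
        exact add_left_cancel h1
    exact fun m => h' m m.2

theorem existsUnique_integrationConstants {k : ℕ} (a b : ℝ) {r : Fin k → ℂ}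
    (hr : Function.Injective r) : ∃! s : Fin k → ℂ, IsIntegrationConstants k a b r s := by
  simp only [isIntegrationConstants_iff]
  have h : IsUnit (Matrix.vandermonde r).transpose.det := by
    rw [Matrix.det_transpose, isUnit_iff_ne_zero]
    exact Matrix.det_vandermonde_ne_zero_iff.mpr hr
  set w : Fin k → ℂ := fun m => ∑ j ∈ Finset.range ((m : ℕ) + 1),
    (Nat.stirlingSecond m j : ℂ) * (sysRHS k a b j : ℂ)
  refine ⟨(Matrix.vandermonde r).transpose⁻¹.mulVec w, ?_, fun s hs => ?_⟩
  · simp only [Matrix.mulVec_mulVec, Matrix.mul_nonsing_inv _ h, Matrix.one_mulVec]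
  · simp only at hs
    rw [← hs, Matrix.mulVec_mulVec, Matrix.nonsing_inv_mul _ h, Matrix.one_mulVec]

theorem conj_descPochhammer_eval (m : ℕ) (z : ℂ) :
    starRingEnd ℂ ((descPochhammer ℂ m).eval z) = (descPochhammer ℂ m).eval (starRingEnd ℂ z) := by
  induction m with
  | zero => simp
  | succ m ih => rw [descPochhammer_succ_eval, descPochhammer_succ_eval, map_mul, ih]; simp

/-- The right-hand sides are real, so conjugating a solution and permuting it along the conjugate
roots gives a solution again; uniqueness finishes. -/
theorem conj_integrationConstants {k : ℕ} {a b : ℝ} {r s : Fin k → ℂ} (hr : Function.Injective r)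
    (hs : IsIntegrationConstants k a b r s) {σ : Equiv.Perm (Fin k)}
    (hσ : ∀ i, r (σ i) = starRingEnd ℂ (r i)) (i : Fin k) : s (σ i) = starRingEnd ℂ (s i) := by
  have h : IsIntegrationConstants k a b r (fun i => starRingEnd ℂ (s (σ i))) := by
    intro m
    have h1 := congrArg (starRingEnd ℂ) (hs m)
    rw [map_sum, Complex.conj_ofReal, ← Equiv.sum_comp σ] at h1
    rw [← h1]
    refine Finset.sum_congr rfl fun i _ => ?_
    rw [map_mul, conj_descPochhammer_eval, hσ, Complex.conj_conj]
  have h2 := congrFun ((existsUnique_integrationConstants a b hr).unique hs h) i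
  rw [h2, Complex.conj_conj]

theorem descPochhammer_eval_neg_one (j : ℕ) :
    (descPochhammer ℂ j).eval (-1) = (-1) ^ j * (j ! : ℂ) := by
  induction j with
  | zero => simp
  | succ j ih =>
    rw [descPochhammer_succ_eval, ih, Nat.factorial_succ]
    push_cast
    ring

/-- For toll one the right-hand side is the `j`-th falling factorial of `-1` divided by `k`, so the
Stirling sum collapses to a power of `-1`. -/
theorem vandermonde_system_of_const_toll {k : ℕ} {r s : Fin k → ℂ}
    (hs : IsIntegrationConstants k 0 1 r s) :
    (Matrix.vandermonde r).transpose.mulVec s = fun m : Fin k => (-1 : ℂ) ^ (m : ℕ) / k := by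
  rw [isIntegrationConstants_iff] at hs
  rw [hs]
  funext m
  rw [pow_eq_sum_stirlingSecond, Finset.sum_div]
  refine Finset.sum_congr rfl fun j _ => ?_
  rw [descPochhammer_eval_neg_one, sysRHS, lead]
  push_cast
  ring

/-- The system says that `∑ s_i p(r_i) = p(-1) / k` for all polynomials `p` of degree below `k`. The
Lagrange basis polynomial at `r i` isolates `s i`. -/
theorem integrationConstants_const_toll {k : ℕ} {r s : Fin k → ℂ} (hr : Function.Injective r)
    (hs : IsIntegrationConstants k 0 1 r s) (i : Fin k) :
    s i = (-1 : ℂ) ^ (k - 1) * (∏ j ∈ Finset.univ.erase i, (r j + 1))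
          / (k * ∏ j ∈ Finset.univ.erase i, (r i - r j)) := by
  have h1 : ∀ p : ℂ[X], p.natDegree < k → ∑ i, s i * p.eval (r i) = p.eval (-1) / k := by
    intro p hp
    have h2 : ∀ m ∈ Finset.range k, ∑ i, s i * r i ^ m = (-1) ^ m / (k : ℂ) := by
      intro m hm
      have h3 := congrFun (vandermonde_system_of_const_toll hs) ⟨m, Finset.mem_range.mp hm⟩
      rwa [vandermonde_transpose_mulVec] at h3
    simp only [eval_eq_sum_range' hp, Finset.mul_sum, Finset.sum_div]
    rw [Finset.sum_comm]
    refine Finset.sum_congr rfl fun m hm => ?_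
    rw [mul_div_assoc, ← h2 m hm, Finset.mul_sum]
    exact Finset.sum_congr rfl fun i _ => mul_left_comm _ _ _
  have hinj : Set.InjOn r (Finset.univ : Finset (Fin k)) := hr.injOn
  have hk : 0 < k := i.pos
  have h4 := h1 (Lagrange.basis Finset.univ r i) (by
    rw [Lagrange.natDegree_basis hinj (Finset.mem_univ i), Finset.card_univ, Fintype.card_fin]
    omega)
  rw [Finset.sum_eq_single i (fun j _ hj => by
      rw [Lagrange.eval_basis_of_ne hj.symm (Finset.mem_univ j), mul_zero])
    (fun h => absurd (Finset.mem_univ i) h), Lagrange.eval_basis_self hinj (Finset.mem_univ i),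
    mul_one] at h4
  rw [h4, Lagrange.basis, eval_prod]
  simp only [Lagrange.basisDivisor, eval_mul, eval_C, eval_sub, eval_X]
  rw [Finset.prod_mul_distrib, Finset.prod_inv_distrib]
  have h5 : ∏ j ∈ Finset.univ.erase i, (-1 - r j)
      = (-1) ^ (k - 1) * ∏ j ∈ Finset.univ.erase i, (r j + 1) := by
    rw [Finset.prod_congr rfl fun j _ => show -1 - r j = -(r j + 1) by ring, Finset.prod_neg,
      Finset.card_erase_of_mem (Finset.mem_univ i), Finset.card_univ, Fintype.card_fin]
  rw [h5]
  field_simp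

theorem indicialPoly_eq_prod {k : ℕ} (hk : 1 ≤ k) {r : Fin k → ℂ} (hinj : Function.Injective r)
    (hr : Set.range r = {z : ℂ | (indicialPoly k).IsRoot z}) :
    indicialPoly k = C ((-1 : ℂ) ^ k) * ∏ i, (X - C (r i)) := by
  have h0 : indicialPoly k ≠ 0 := by
    rw [← leadingCoeff_ne_zero, leadingCoeff_indicialPoly hk]; simp
  have h1 : (indicialPoly k).roots = Finset.univ.val.map r := by
    rw [Multiset.Nodup.ext (nodup_roots_indicialPoly hk) (Finset.univ.nodup.map hinj)]
    intro z
    rw [mem_roots h0]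
    have : (indicialPoly k).IsRoot z ↔ z ∈ Set.range r := by rw [hr]; rfl
    rw [this]
    simp
  have h2 := C_leadingCoeff_mul_prod_multiset_X_sub_C
    (IsAlgClosed.card_roots_eq_natDegree (p := indicialPoly k))
  rw [leadingCoeff_indicialPoly hk, h1, Multiset.map_map] at h2
  exact h2.symm

theorem sum_range_inv_add_two (k : ℕ) :
    ∑ j ∈ Finset.range k, 1 / ((j : ℝ) + 2) = H (k + 1) - 1 := by
  induction k with
  | zero => simp [H_one]
  | succ k ih => rw [Finset.sum_range_succ, ih, H_succ (k + 1)]; push_cast; ring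

/-- In the product formula the numerator is, up to sign, the value `k! - (k + 1)!` of the indicial
polynomial at `-1`, where the factor of the root `-2` equals `1`. The denominator comes from its
derivative at `-2`, which is `-(k + 1)! (H_{k+1} - 1)`. -/
theorem integrationConstant_neg_two {k : ℕ} (hk : 1 ≤ k) {r s : Fin k → ℂ}
    (hinj : Function.Injective r) (hr : Set.range r = {z : ℂ | (indicialPoly k).IsRoot z})
    (hs : IsIntegrationConstants k 0 1 r s) {i : Fin k} (hi : r i = -2) :
    s i = ((1 / ((k + 1) * (H (k + 1) - 1)) : ℝ) : ℂ) := by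
  have hP := indicialPoly_eq_prod hk hinj hr
  have h1 : (indicialPoly k).eval (-1) = (k ! : ℂ) - ((k + 1)! : ℕ) := by
    rw [indicialPoly, eval_sub, eval_mul, eval_C, eval_C, descPochhammer_eval_neg_one, ← mul_assoc,
      ← mul_pow]
    simp
  rw [hP, eval_mul, eval_C, eval_prod, ← Finset.mul_prod_erase _ _ (Finset.mem_univ i)] at h1
  have h2 := derivative_indicialPoly_eval (isRoot_neg_two k)
  have h3 : ∑ j ∈ Finset.range k, 1 / ((j : ℂ) - (-2)) = ((H (k + 1) - 1 : ℝ) : ℂ) := by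
    rw [← sum_range_inv_add_two]
    push_cast
    simp
  rw [h3, hP, derivative_C_mul, eval_mul, eval_C, ← hi, derivative_prod_finset, eval_finsetSum,
    Finset.sum_eq_single i] at h2
  rotate_left
  · intro j _ hj
    rw [eval_mul, eval_prod, Finset.prod_eq_zero (Finset.mem_erase.mpr ⟨hj.symm, Finset.mem_univ i⟩)
      (by simp), zero_mul]
  · intro h; exact absurd (Finset.mem_univ i) h
  rw [eval_mul, eval_prod] at h2
  simp only [eval_sub, eval_X, eval_C, derivative_sub, derivative_X, derivative_C, sub_zero,
    eval_one, mul_one] at h1 h2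
  rw [integrationConstants_const_toll hinj hs i]
  have h5 : ∏ j ∈ Finset.univ.erase i, (-1 - r j)
      = (-1) ^ (k - 1) * ∏ j ∈ Finset.univ.erase i, (r j + 1) := by
    rw [Finset.prod_congr rfl fun j _ => show -1 - r j = -(r j + 1) by ring, Finset.prod_neg,
      Finset.card_erase_of_mem (Finset.mem_univ i), Finset.card_univ, Fintype.card_fin]
  rw [h5, hi] at h1
  have hH := one_lt_H hk
  have hH' : ((H (k + 1) : ℝ) : ℂ) - 1 ≠ 0 := by
    rw [← Complex.ofReal_one, ← Complex.ofReal_sub]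
    exact_mod_cast (sub_pos.mpr hH).ne'
  set D := ∏ j ∈ Finset.univ.erase i, (r i - r j)
  set N := ∏ j ∈ Finset.univ.erase i, (r j + 1)
  obtain ⟨k, rfl⟩ : ∃ m, k = m + 1 := ⟨k - 1, by omega⟩
  have hD : D ≠ 0 := Finset.prod_ne_zero_iff.mpr fun j hj =>
    sub_ne_zero.mpr fun h => (Finset.mem_erase.mp hj).1 (hinj h).symm
  have hf : ((k + 1)! : ℂ) ≠ 0 := by exact_mod_cast Nat.factorial_ne_zero _
  have hk1 : ((k : ℂ) + 1) ≠ 0 := by exact_mod_cast Nat.succ_ne_zero k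
  have hk2 : ((k : ℂ) + 1 + 1) ≠ 0 := by exact_mod_cast Nat.succ_ne_zero (k + 1)
  rw [Nat.factorial_succ (k + 1)] at h1 h2
  rw [Nat.add_sub_cancel] at h1 ⊢
  have e : (-1 : ℂ) ^ (k + 1) = -(-1) ^ k := by ring
  have e2 : (-1 : ℂ) ^ k * (-1) ^ k = 1 := by rw [← mul_pow]; simp
  rw [e] at h1 h2
  push_cast at h1 h2 ⊢
  have hD2 : D = (-1) ^ k * ((k + 1 + 1) * (k + 1)! * (H (k + 1 + 1) - 1)) := by
    linear_combination (-(-1) ^ k) * h2 - D * e2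
  have hN : N = (k + 1) * (k + 1)! := by
    linear_combination -h1 - N * e2
  have e3 : (-1 : ℂ) ^ k ≠ 0 := by simp
  rw [hD2, hN]
  field_simp


/-! ### The generating function. -/

theorem hasFPowerSeriesOnBall_of_hasSum {c : ℕ → ℂ} {f : ℂ → ℂ}
    (h : ∀ x : ℂ, ‖x‖ < 1 → HasSum (fun n => c n * x ^ n) (f x)) :
    HasFPowerSeriesOnBall f (FormalMultilinearSeries.ofScalars ℂ c) 0 1 where
  r_le := by
    refine ENNReal.le_of_forall_nnreal_lt fun ρ hρ => ?_
    refine FormalMultilinearSeries.le_radius_of_summable _ ?_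
    have h1 : ‖((ρ : ℝ) : ℂ)‖ < 1 := by
      rw [Complex.norm_real, NNReal.norm_eq]
      exact_mod_cast hρ
    have h2 := (h _ h1).summable.norm
    refine h2.congr fun n => ?_
    rw [FormalMultilinearSeries.ofScalars_norm, norm_mul, norm_pow, Complex.norm_real,
      NNReal.norm_eq]
  r_pos := one_pos
  hasSum := by
    intro y hy
    have hy' : ‖y‖ < 1 := by
      rw [← ENNReal.ofReal_one, Metric.eball_ofReal] at hy
      simpa using hy
    simpa [FormalMultilinearSeries.ofScalars_apply_eq, mul_comm] using h y hy'

/-- Termwise `k`-fold differentiation of a power series in the unit disc. -/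
theorem hasSum_iteratedDeriv {c : ℕ → ℂ} {f : ℂ → ℂ}
    (h : ∀ x : ℂ, ‖x‖ < 1 → HasSum (fun n => c n * x ^ n) (f x)) (k : ℕ) {x : ℂ} (hx : ‖x‖ < 1) :
    HasSum (fun n => ((n + k).choose k : ℂ) * c (n + k) * x ^ n) (iteratedDeriv k f x / (k ! : ℂ)) := by
  have hf := hasFPowerSeriesOnBall_of_hasSum h
  have h0 : ∀ n, iteratedDeriv n f 0 = n ! * c n := by
    intro n
    have := hf.factorial_smul 1 n
    rw [← iteratedDeriv_eq_iteratedFDeriv, FormalMultilinearSeries.ofScalars_apply_eq] at this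
    simpa using this.symm
  have hball : Metric.eball (0 : ℂ) 1 = Metric.ball 0 1 := by
    rw [← ENNReal.ofReal_one, Metric.eball_ofReal]
  have hd : DifferentiableOn ℂ (iteratedDeriv k f) (Metric.ball 0 1) := by
    rw [iteratedDeriv_eq_iterate, ← hball]
    exact (hf.analyticOnNhd.iterated_deriv k).differentiableOn
  -- The `k`-th derivative is holomorphic in the disc, so it is the sum of its own Taylor series,
  -- whose coefficients are higher derivatives of `f` at `0`.
  have h1 := Complex.hasSum_taylorSeries_on_ball hd (z := x) (by simpa using hx)
  refine (h1.div_const (k ! : ℂ)).congr_fun fun n => ?_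
  have h2 : iteratedDeriv n (iteratedDeriv k f) 0 = iteratedDeriv (n + k) f 0 := by
    rw [iteratedDeriv_eq_iterate, iteratedDeriv_eq_iterate, iteratedDeriv_eq_iterate,
      Function.iterate_add_apply]
  rw [h2, h0, ← Nat.add_choose_mul_factorial_mul_factorial, sub_zero, smul_eq_mul, smul_eq_mul]
  have hn : (n ! : ℂ) ≠ 0 := by exact_mod_cast n.factorial_ne_zero
  have hk : (k ! : ℂ) ≠ 0 := by exact_mod_cast k.factorial_ne_zero
  push_cast
  field_simp

theorem hasSum_binomCoeff (r : ℂ) {x : ℂ} (hx : ‖x‖ < 1) :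
    HasSum (fun n => binomCoeff r n * x ^ n) ((1 - x) ^ r) := by
  have h := (Complex.one_add_cpow_hasFPowerSeriesOnBall_zero (a := r)).hasSum (y := -x) (by
    rw [← ENNReal.ofReal_one, Metric.eball_ofReal]; simpa using hx)
  rw [zero_add, ← sub_eq_add_neg] at h
  refine h.congr_fun fun n => ?_
  rw [binomialSeries_apply, List.ofFn_const, List.prod_replicate, binomCoeff, smul_eq_mul, neg_pow]
  ring

theorem one_sub_ne_zero {x : ℂ} (hx : ‖x‖ < 1) : 1 - x ≠ 0 := by
  intro h
  rw [sub_eq_zero] at h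
  rw [← h] at hx
  simp at hx

theorem hasSum_choose_mul_pow (k : ℕ) {x : ℂ} (hx : ‖x‖ < 1) :
    HasSum (fun n => ((n + k).choose k : ℂ) * x ^ n) (((1 - x) ^ (k + 1))⁻¹) := by
  have h := hasSum_binomCoeff (-((k : ℂ) + 1)) hx
  simp only [binomCoeff_neg] at h
  rwa [Complex.cpow_neg, show ((k : ℂ) + 1) = ((k + 1 : ℕ) : ℂ) by push_cast; rfl,
    Complex.cpow_natCast] at h

theorem hasSum_cauchyProduct {c d : ℕ → ℂ} {x u v : ℂ} (hc : HasSum (fun n => c n * x ^ n) u)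
    (hd : HasSum (fun n => d n * x ^ n) v) :
    HasSum (fun n => (∑ m ∈ Finset.range (n + 1), d (n - m) * c m) * x ^ n) (u * v) := by
  have h := hasSum_sum_range_mul_of_summable_norm hc.summable.norm hd.summable.norm
  rw [hc.tsum_eq, hd.tsum_eq] at h
  refine h.congr_fun fun n => ?_
  rw [Finset.sum_mul]
  refine Finset.sum_congr rfl fun m hm => ?_
  rw [Finset.mem_range] at hm
  rw [← Nat.sub_add_cancel (show m ≤ n by omega), pow_add, Nat.add_sub_cancel]
  ring

theorem sum_inv_eq_H (n : ℕ) : ∑ m ∈ Finset.range (n + 1), (1 / (m : ℝ)) = H n := by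
  induction n with
  | zero => simp [H_zero]
  | succ n ih => rw [Finset.sum_range_succ, ih, H_succ]; push_cast; rfl

theorem sum_mul_inv_eq (n : ℕ) :
    ∑ m ∈ Finset.range (n + 1), ((n - m + 1).choose 1 : ℝ) * (1 / (m : ℝ)) = (n + 1) * H n - n := by
  induction n with
  | zero => simp [H_zero]
  | succ n ih =>
    have h : ∀ m ∈ Finset.range (n + 1), ((n + 1 - m + 1).choose 1 : ℝ) * (1 / (m : ℝ))
        = ((n - m + 1).choose 1 : ℝ) * (1 / (m : ℝ)) + 1 / (m : ℝ) := by
      intro m hm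
      rw [Finset.mem_range] at hm
      rw [show n + 1 - m + 1 = (n - m + 1) + 1 by omega, Nat.choose_one_right, Nat.choose_one_right]
      push_cast
      ring
    rw [Finset.sum_range_succ, Finset.sum_congr rfl h, Finset.sum_add_distrib, ih, sum_inv_eq_H,
      H_succ]
    simp
    field_simp
    ring

theorem hasSum_harmonic {x : ℂ} (hx : ‖x‖ < 1) :
    HasSum (fun n : ℕ => (((n + 1) * H n - n : ℝ) : ℂ) * x ^ n)
      (-Complex.log (1 - x) / (1 - x) ^ 2) := by
  -- The constant term is correct because `1 / 0 = 0`. The Cauchy product with `(1 - x) ^ (-2)` then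
  -- yields the harmonic coefficients.
  have h1 : HasSum (fun n : ℕ => (1 / (n : ℂ)) * x ^ n) (-Complex.log (1 - x)) :=
    (Complex.hasSum_taylorSeries_neg_log hx).congr_fun fun n => by ring
  have h2 := hasSum_cauchyProduct h1 (hasSum_choose_mul_pow 1 hx)
  rw [← div_eq_mul_inv] at h2
  refine h2.congr_fun fun n => ?_
  rw [← sum_mul_inv_eq]
  push_cast
  rfl

theorem hasSum_expectedCost {k : ℕ} {τ : List ℕ → ℝ} {a b : ℝ} (hτ : HasAverageToll (k + 1) τ a b)
    {r s : Fin (k + 1) → ℂ} (hr : ∀ i, (indicialPoly (k + 1)).IsRoot (r i))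
    (hs : IsIntegrationConstants (k + 1) a b r s) {x : ℂ} (hx : ‖x‖ < 1) :
    HasSum (fun n => (expectedCost (k + 1) τ n : ℂ) * x ^ n)
      (-(lead (k + 1) a : ℂ) * Complex.log (1 - x) / (1 - x) ^ 2
        + (1 / ((k + 1 : ℕ) : ℂ)) * ((a - b : ℂ) / (1 - x)) + ∑ i, s i * (1 - x) ^ (r i)) := by
  have h1 := (hasSum_harmonic hx).mul_left (lead (k + 1) a : ℂ)
  have h2 := (hasSum_choose_mul_pow 0 hx).mul_left ((a - b : ℂ) / (k + 1))
  have h3 : HasSum (fun n => ∑ i, s i * (binomCoeff (r i) n * x ^ n)) (∑ i, s i * (1 - x) ^ (r i)) :=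
    hasSum_sum fun i _ => (hasSum_binomCoeff (r i) hx).mul_left (s i)
  have h4 := (h1.add h2).add h3
  have e : -(lead (k + 1) a : ℂ) * Complex.log (1 - x) / (1 - x) ^ 2
        + (1 / ((k + 1 : ℕ) : ℂ)) * ((a - b : ℂ) / (1 - x))
      = (lead (k + 1) a : ℂ) * (-Complex.log (1 - x) / (1 - x) ^ 2)
        + (a - b : ℂ) / (k + 1) * ((1 - x) ^ (0 + 1))⁻¹ := by
    push_cast
    ring
  rw [e]
  refine h4.congr_fun fun n => ?_
  rw [expectedCost_eq hτ hr hs, add_mul, Finset.sum_mul]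
  push_cast
  simp only [Nat.choose_zero_right, Nat.cast_one, ← mul_assoc]
  ring

/-- The Cauchy–Euler equation of the generating function. -/
theorem genFun_ode {k : ℕ} {τ : List ℕ → ℝ} {a b : ℝ} (hτ : HasAverageToll (k + 1) τ a b)
    (hsum : ∀ x : ℂ, ‖x‖ < 1 → Summable (fun n => (expectedCost (k + 1) τ n : ℂ) * x ^ n))
    {x : ℂ} (hx : ‖x‖ < 1) :
    iteratedDeriv (k + 1) (genFun (k + 1) τ) x * (1 - x) ^ (k + 1) / ((k + 1)! : ℂ)
      = (a * (x + (k + 1 : ℕ)) + b * (1 - x)) / (1 - x) ^ 2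
        + ((k + 1 : ℕ) + 1) * genFun (k + 1) τ x := by
  have hg : ∀ x : ℂ, ‖x‖ < 1 →
      HasSum (fun n => (expectedCost (k + 1) τ n : ℂ) * x ^ n) (genFun (k + 1) τ x) :=
    fun x hx => (hsum x hx).hasSum
  have h1 := hasSum_iteratedDeriv hg (k + 1) hx
  have h2 := (hasSum_cauchyProduct (hg x hx) (hasSum_choose_mul_pow k hx)).mul_left ((k : ℂ) + 2)
  -- With `N = n + k + 1` the toll is split as `a N + b = a (N + 1) - (a - b)`. Since `(N + 1) C(N,
  -- k + 1) = (k + 2) C(N + 1, k + 2)`, its two parts sum to multiples of `(1 - x) ^ (-(k + 3))` and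
  -- `(1 - x) ^ (-(k + 2))`.
  have h3 := (hasSum_choose_mul_pow (k + 2) hx).mul_left ((a : ℂ) * (k + 2))
  have h4 := (hasSum_choose_mul_pow (k + 1) hx).mul_left (-(a - b : ℂ))
  have h5 := h1.unique (((h3.add h4).add h2).congr_fun fun n => by
    have e1 := congrArg (fun x : ℝ => (x : ℂ)) (expectedCost_recurrence hτ (Nat.le_add_left (k + 1) n))
    simp only [Complex.ofReal_mul, Complex.ofReal_add, Complex.ofReal_sum,
      Complex.ofReal_natCast] at e1
    rw [sum_range_choose_eq (Nat.le_add_left (k + 1) n), Nat.add_sub_cancel] at e1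
    have e2 : ((n + (k + 1) + 1 : ℕ) : ℂ) * (n + (k + 1)).choose (k + 1)
        = (n + (k + 2)).choose (k + 2) * ((k + 2 : ℕ) : ℂ) := by
      exact_mod_cast Nat.add_one_mul_choose_eq (n + (k + 1)) (k + 1)
    rw [e1]
    push_cast at e2 ⊢
    linear_combination (a * x ^ n) * e2)
  have hne := one_sub_ne_zero hx
  rw [mul_comm, mul_div_assoc, h5]
  push_cast
  field_simp
  ring

open Filter Asymptotics Topology

/-! ### Asymptotics. -/

theorem binomCoeff_natCast_eventually (m : ℕ) : ∀ᶠ n : ℕ in atTop, binomCoeff (m : ℂ) n = 0 := by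
  filter_upwards [eventually_gt_atTop m] with n hn
  rw [binomCoeff, Ring.choose_natCast, Nat.choose_eq_zero_of_lt hn]
  simp

/-- Euler's product for `Γ(-r)` has `n + 1` factors, one more than the binomial coefficient; the
surplus factor is `n - r`. -/
theorem binomCoeff_mul_GammaSeq {r : ℂ} (hr : ∀ m : ℕ, r ≠ m) {n : ℕ} (hn : 0 < n) :
    binomCoeff r n = (n : ℂ) ^ (-r) * (n - r)⁻¹ * (Complex.GammaSeq (-r) n)⁻¹ := by
  have h1 : (n ! : ℂ) * binomCoeff r n = ∏ j ∈ Finset.range n, ((j : ℂ) - r) := by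
    rw [← neg_one_pow_mul_descPochhammer_eval, ← factorial_mul_choose, binomCoeff]
    ring
  have h2 : ∀ j : ℕ, (j : ℂ) - r ≠ 0 := fun j => sub_ne_zero.mpr (hr j).symm
  have h3 : ∏ j ∈ Finset.range n, ((j : ℂ) - r) ≠ 0 := Finset.prod_ne_zero_iff.mpr fun j _ => h2 j
  have h4 : (n ! : ℂ) ≠ 0 := by exact_mod_cast n.factorial_ne_zero
  have h5 : (n : ℂ) ^ (-r) ≠ 0 := by
    intro h
    rw [Complex.cpow_eq_zero_iff] at h
    exact hn.ne' (by exact_mod_cast h.1)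
  have h6 : ∏ j ∈ Finset.range (n + 1), (-r + (j : ℂ))
      = (∏ j ∈ Finset.range n, ((j : ℂ) - r)) * (n - r) := by
    rw [← Finset.prod_range_succ]
    exact Finset.prod_congr rfl fun j _ => by ring
  rw [Complex.GammaSeq, h6]
  apply mul_left_cancel₀ h4
  rw [h1]
  have := h2 n
  field_simp

/-- Euler's sequence tends to `Γ(-r) ≠ 0`, so the order is that of `n ^ (-r) / n`. At natural `r`,
the poles of `Γ(-r)`, the coefficients vanish eventually. -/
theorem binomCoeff_isBigO (r : ℂ) :
    (fun n : ℕ => binomCoeff r n) =O[atTop] (fun n : ℕ => (n : ℝ) ^ (-(r.re + 1))) := by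
  by_cases hr : ∃ m : ℕ, r = m
  · obtain ⟨m, rfl⟩ := hr
    refine (EventuallyEq.isBigO (f₂ := fun _ => (0 : ℂ)) ?_).trans (isBigO_zero _ _)
    exact binomCoeff_natCast_eventually m
  push Not at hr
  have h1 : (fun n : ℕ => (n : ℂ) ^ (-r)) =O[atTop] (fun n : ℕ => (n : ℝ) ^ (-r.re)) := by
    refine IsBigO.of_bound 1 ?_
    filter_upwards [eventually_gt_atTop 0] with n hn
    rw [Complex.norm_natCast_cpow_of_pos hn, one_mul, Complex.neg_re]
    exact le_abs_self _
  have h2 : (fun n : ℕ => ((n : ℂ) - r)⁻¹) =O[atTop] (fun n : ℕ => (n : ℝ)⁻¹) := by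
    refine IsBigO.inv_rev ?_ ?_
    · refine IsBigO.of_bound 2 ?_
      filter_upwards [eventually_ge_atTop ⌈2 * ‖r‖⌉₊] with n hn
      have h3 : 2 * ‖r‖ ≤ n := (Nat.le_ceil _).trans (by exact_mod_cast hn)
      have h4 := norm_sub_norm_le (n : ℂ) r
      rw [Complex.norm_natCast] at h4
      rw [Real.norm_natCast]
      linarith
    · filter_upwards [eventually_gt_atTop 0] with n hn h
      exact absurd h (by exact_mod_cast hn.ne')
  have h3 : (fun n : ℕ => (Complex.GammaSeq (-r) n)⁻¹) =O[atTop] (fun _ : ℕ => (1 : ℝ)) := by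
    refine ((Complex.GammaSeq_tendsto_Gamma (-r)).inv₀ ?_).isBigO_one ℝ
    exact Complex.Gamma_ne_zero fun m h => hr m (neg_injective h)
  refine ((h1.mul h2).mul h3).congr' ?_ ?_
  · filter_upwards [eventually_gt_atTop 0] with n hn
    exact (binomCoeff_mul_GammaSeq hr hn).symm
  · filter_upwards [eventually_gt_atTop 0] with n hn
    have : (0 : ℝ) < n := by exact_mod_cast hn
    rw [mul_one, neg_add, Real.rpow_add this, Real.rpow_neg_one]

theorem binomCoeff_isLittleO {r : ℂ} (hr : -2 < r.re) :
    (fun n : ℕ => binomCoeff r n) =o[atTop] (fun n : ℕ => (n : ℝ)) := by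
  refine (binomCoeff_isBigO r).trans_isLittleO ?_
  have h1 : Tendsto (fun n : ℕ => (n : ℝ) ^ (-(r.re + 2))) atTop (𝓝 0) :=
    (tendsto_rpow_neg_atTop (by linarith)).comp tendsto_natCast_atTop_atTop
  have h2 := (isBigO_refl (fun n : ℕ => (n : ℝ)) atTop).mul_isLittleO ((isLittleO_one_iff ℝ).mpr h1)
  refine h2.congr' ?_ (Eventually.of_forall fun n => mul_one _)
  filter_upwards [eventually_gt_atTop 0] with n hn
  have : (0 : ℝ) < n := by exact_mod_cast hn
  rw [show -(r.re + 1) = 1 + -(r.re + 2) by ring, Real.rpow_add this, Real.rpow_one]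

theorem tendsto_H_sub_log :
    Tendsto (fun n : ℕ => H n - Real.log n) atTop (𝓝 Real.eulerMascheroniConstant) :=
  Real.tendsto_harmonic_sub_log

theorem const_isLittleO_natCast (c : ℝ) : (fun _ : ℕ => c) =o[atTop] (fun n : ℕ => (n : ℝ)) :=
  isLittleO_const_left.mpr (Or.inr (tendsto_norm_atTop_atTop.comp tendsto_natCast_atTop_atTop))

theorem H_isLittleO : (fun n : ℕ => H n) =o[atTop] (fun n : ℕ => (n : ℝ)) := by
  have h1 : (fun n : ℕ => H n - Real.log n) =o[atTop] (fun n : ℕ => (n : ℝ)) :=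
    (tendsto_H_sub_log.isBigO_one ℝ).trans_isLittleO (const_isLittleO_natCast 1)
  have h2 : (fun n : ℕ => Real.log n) =o[atTop] (fun n : ℕ => (n : ℝ)) :=
    Real.isLittleO_log_id_atTop.comp_tendsto tendsto_natCast_atTop_atTop
  refine (h1.add h2).congr_left fun n => ?_
  ring

theorem harmonic_asymptotics :
    (fun n : ℕ => ((n + 1) * H n - n) - (n * Real.log n + (Real.eulerMascheroniConstant - 1) * n))
      =o[atTop] (fun n : ℕ => (n : ℝ)) := by
  have h1 : (fun n : ℕ => (n : ℝ) * (H n - Real.log n - Real.eulerMascheroniConstant))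
      =o[atTop] (fun n : ℕ => (n : ℝ) * (1 : ℝ)) := by
    refine (isBigO_refl _ _).mul_isLittleO ((isLittleO_one_iff ℝ).mpr ?_)
    simpa using tendsto_H_sub_log.sub_const Real.eulerMascheroniConstant
  simp only [mul_one] at h1
  refine (h1.add H_isLittleO).congr_left fun n => ?_
  ring

theorem binomCoeff_neg_two (n : ℕ) : binomCoeff (-2) n = n + 1 := by
  have h := binomCoeff_neg 1 n
  rw [Nat.choose_one_right] at h
  push_cast at h
  rw [← h]
  norm_num

theorem conj_binomCoeff (r : ℂ) (n : ℕ) :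
    starRingEnd ℂ (binomCoeff r n) = binomCoeff (starRingEnd ℂ r) n := by
  have h4 : (n ! : ℂ) ≠ 0 := by exact_mod_cast n.factorial_ne_zero
  apply mul_left_cancel₀ h4
  have h := conj_descPochhammer_eval n r
  rw [← factorial_mul_choose, ← factorial_mul_choose] at h
  simp only [map_mul, Complex.conj_natCast] at h
  simp only [binomCoeff, map_mul, map_pow, map_neg, map_one]
  linear_combination (-1) ^ n * h

section
variable {k : ℕ} {τ : List ℕ → ℝ} {a b : ℝ} {r s : Fin (k + 1) → ℂ} {i₀ : Fin (k + 1)}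

theorem integrationConstant_im_eq_zero (hinj : Function.Injective r)
    (hr : Set.range r = {z : ℂ | (indicialPoly (k + 1)).IsRoot z}) (h0 : r i₀ = -2)
    (hs : IsIntegrationConstants (k + 1) a b r s) : (s i₀).im = 0 := by
  obtain ⟨σ, hσ, -⟩ := exists_conj_index hinj hr
  -- The root `-2` is its own conjugate, so its constant is fixed by conjugation.
  have h1 : σ i₀ = i₀ := by
    apply hinj
    rw [hσ, h0, map_neg, map_ofNat]
  have h2 := conj_integrationConstants hinj hs hσ i₀
  rw [h1] at h2
  exact Complex.conj_eq_iff_im.mp h2.symm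

theorem expectedCost_eq_re (hτ : HasAverageToll (k + 1) τ a b)
    (hr : Set.range r = {z : ℂ | (indicialPoly (k + 1)).IsRoot z}) (h0 : r i₀ = -2)
    (hs : IsIntegrationConstants (k + 1) a b r s) (n : ℕ) :
    expectedCost (k + 1) τ n = lead (k + 1) a * ((n + 1) * H n - n) + (s i₀).re * (n + 1)
      + (∑ i ∈ Finset.univ.erase i₀, (s i * binomCoeff (r i) n).re + (a - b) / (k + 1)) := by
  have hroot : ∀ i, (indicialPoly (k + 1)).IsRoot (r i) := fun i => by
    have : r i ∈ Set.range r := ⟨i, rfl⟩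
    rwa [hr] at this
  have h1 := congrArg Complex.re (expectedCost_eq hτ hroot hs n)
  rw [Complex.ofReal_re, Complex.add_re, Complex.ofReal_re, Complex.re_sum,
    ← Finset.add_sum_erase _ _ (Finset.mem_univ i₀), h0, binomCoeff_neg_two] at h1
  have h2 : (s i₀ * ((n : ℂ) + 1)).re = (s i₀).re * (n + 1) := by
    simp [Complex.mul_re]
  rw [h1, h2]
  ring

theorem expectedCost_sub_isLittleO (hτ : HasAverageToll (k + 1) τ a b)
    (hinj : Function.Injective r)
    (hr : Set.range r = {z : ℂ | (indicialPoly (k + 1)).IsRoot z}) (h0 : r i₀ = -2)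
    (hs : IsIntegrationConstants (k + 1) a b r s) :
    (fun n : ℕ => expectedCost (k + 1) τ n
        - (lead (k + 1) a * ((n + 1) * H n - n) + (s i₀).re * (n + 1)))
      =o[atTop] (fun n : ℕ => (n : ℝ)) := by
  have h1 : (fun n : ℕ => ∑ i ∈ Finset.univ.erase i₀, (s i * binomCoeff (r i) n).re
      + (a - b) / (k + 1)) =o[atTop] (fun n : ℕ => (n : ℝ)) := by
    refine (IsLittleO.fun_sum fun i hi => ?_).add (const_isLittleO_natCast _)
    have h2 : -2 < (r i).re := by
      refine neg_two_lt_re (k := k + 1) (by omega) ?_ ?_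
      · have : r i ∈ Set.range r := ⟨i, rfl⟩
        rwa [hr] at this
      · rw [← h0]
        exact fun h => (Finset.mem_erase.mp hi).1 (hinj h)
    refine IsBigO.trans_isLittleO ?_ ((binomCoeff_isLittleO h2).const_mul_left (s i))
    exact IsBigO.of_bound 1 (Eventually.of_forall fun n => by
      rw [one_mul]; exact Complex.abs_re_le_norm _)
  refine h1.congr_left fun n => ?_
  rw [expectedCost_eq_re hτ hr h0 hs]
  ring

/-- Conjugate roots contribute equal real parts, hence the factor `2`. The only other possible real
root is the natural number `k + 2`, whose binomial coefficients are eventually zero, so only bounded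
terms remain. -/
theorem expectedCost_sub_isBigO_one (hτ : HasAverageToll (k + 1) τ a b)
    (hinj : Function.Injective r)
    (hr : Set.range r = {z : ℂ | (indicialPoly (k + 1)).IsRoot z}) (h0 : r i₀ = -2)
    (hs : IsIntegrationConstants (k + 1) a b r s) :
    (fun n : ℕ => expectedCost (k + 1) τ n
        - (lead (k + 1) a * ((n + 1) * H n - n) + (s i₀).re * (n + 1)
          + 2 * ∑ i ∈ Finset.univ.filter (fun i => 0 < (r i).im),
              (-1) ^ n * (s i * Ring.choose (r i) n).re))
      =O[atTop] (fun _ : ℕ => (1 : ℝ)) := by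
  obtain ⟨σ, hσ, hσσ⟩ := exists_conj_index hinj hr
  have hconj := conj_integrationConstants hinj hs hσ
  set t : Fin (k + 1) → ℕ → ℝ := fun i n => (s i * binomCoeff (r i) n).re
  have ht : ∀ i n, t (σ i) n = t i n := by
    intro i n
    simp only [t, hconj, hσ, ← conj_binomCoeff, ← map_mul, Complex.conj_re]
  have hneg : ∀ n, ∑ i ∈ Finset.univ.filter (fun i => (r i).im < 0), t i n
      = ∑ i ∈ Finset.univ.filter (fun i => 0 < (r i).im), t i n := by
    intro n
    refine Finset.sum_nbij' σ σ ?_ ?_ (fun i _ => hσσ i) (fun i _ => hσσ i) (fun i _ => (ht i n).symm)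
    · intro i hi; simpa [hσ] using hi
    · intro i hi; simpa [hσ] using hi
  have hsplit : ∀ n, ∑ i ∈ Finset.univ.erase i₀, t i n
      = 2 * ∑ i ∈ Finset.univ.filter (fun i => 0 < (r i).im), t i n
        + ∑ i ∈ (Finset.univ.erase i₀).filter (fun i => (r i).im = 0), t i n := by
    intro n
    rw [← Finset.sum_filter_add_sum_filter_not (Finset.univ.erase i₀) (fun i => (r i).im = 0)
      (fun i => t i n), add_comm, two_mul]
    congr 1
    nth_rw 1 [← hneg]
    rw [← Finset.sum_union]
    · refine Finset.sum_congr ?_ fun _ _ => rfl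
      ext i
      simp only [Finset.mem_filter, Finset.mem_erase, Finset.mem_univ, Finset.mem_union, true_and,
        and_true]
      refine ⟨fun h => lt_or_gt_of_ne h.2, fun h => ⟨?_, h.elim ne_of_lt fun h => h.ne'⟩⟩
      rintro rfl
      rw [h0] at h
      simp at h
    · rw [Finset.disjoint_filter]
      intro i _ h4 h5
      linarith
  have hzero : (fun n => ∑ i ∈ (Finset.univ.erase i₀).filter (fun i => (r i).im = 0), t i n)
      =O[atTop] (fun _ : ℕ => (1 : ℝ)) := by
    refine IsBigO.fun_sum fun i hi => ?_
    simp only [Finset.mem_filter, Finset.mem_erase, Finset.mem_univ, and_true] at hi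
    have hi2 : r i = ((k + 2 : ℕ) : ℂ) := by
      have he : (((r i).re : ℝ) : ℂ) = r i := Complex.ext rfl (by simp [hi.2])
      have h2 : r i ∈ Set.range r := ⟨i, rfl⟩
      rw [hr] at h2
      change (indicialPoly (k + 1)).IsRoot (r i) at h2
      rw [← he] at h2
      rcases real_root (by omega) h2 with h3 | ⟨h3, h4⟩
      · exact absurd (hinj (by rw [← he, h3, h0]; simp)) hi.1
      · rw [← he, h4]; push_cast; ring
    refine (EventuallyEq.isBigO (f₂ := fun _ => (0 : ℝ)) ?_).trans (isBigO_zero _ _)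
    filter_upwards [binomCoeff_natCast_eventually (k + 2)] with n hn
    simp only [t, hi2, hn, mul_zero, Complex.zero_re]
  refine (hzero.add (isBigO_refl (fun _ : ℕ => (1 : ℝ)) atTop |>.const_mul_left ((a - b) / (k + 1)))).congr_left
    fun n => ?_
  have h5 : ∀ i, (-1) ^ n * (s i * Ring.choose (r i) n).re = t i n := by
    intro i
    simp only [t, binomCoeff]
    rw [← Complex.re_ofReal_mul]
    push_cast
    congr 1
    ring
  simp only [h5]
  rw [expectedCost_eq_re hτ hr h0 hs, hsplit]
  ring

theorem expectedCost_sub_log_isLittleO (hτ : HasAverageToll (k + 1) τ a b)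
    (hinj : Function.Injective r)
    (hr : Set.range r = {z : ℂ | (indicialPoly (k + 1)).IsRoot z}) (h0 : r i₀ = -2)
    (hs : IsIntegrationConstants (k + 1) a b r s) :
    (fun n : ℕ => expectedCost (k + 1) τ n - (lead (k + 1) a * (n * Real.log n)
        + ((s i₀).re + lead (k + 1) a * (Real.eulerMascheroniConstant - 1)) * n))
      =o[atTop] (fun n : ℕ => (n : ℝ)) := by
  have h1 := expectedCost_sub_isLittleO hτ hinj hr h0 hs
  have h2 := harmonic_asymptotics.const_mul_left (lead (k + 1) a)
  refine ((h1.add h2).add (const_isLittleO_natCast (s i₀).re)).congr_left fun n => ?_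
  ring

theorem expectedCost_sub_log_isBigO (hτ : HasAverageToll (k + 1) τ a b)
    (hinj : Function.Injective r)
    (hr : Set.range r = {z : ℂ | (indicialPoly (k + 1)).IsRoot z}) (h0 : r i₀ = -2)
    (hs : IsIntegrationConstants (k + 1) a b r s) :
    (fun n : ℕ => expectedCost (k + 1) τ n - lead (k + 1) a * (n * Real.log n))
      =O[atTop] (fun n : ℕ => (n : ℝ)) := by
  have h1 := (expectedCost_sub_log_isLittleO hτ hinj hr h0 hs).isBigO
  have h2 := (isBigO_refl (fun n : ℕ => (n : ℝ)) atTop).const_mul_left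
    ((s i₀).re + lead (k + 1) a * (Real.eulerMascheroniConstant - 1))
  refine (h1.add h2).congr_left fun n => ?_
  ring

end

theorem hasAverageToll_one (k : ℕ) : HasAverageToll k (fun _ => 1) 0 1 := by
  intro s _
  rw [average, Finset.sum_const, card_orderings]
  have : (s.card ! : ℝ) ≠ 0 := by positivity
  simp [this]

end MultipivotQuicksort

/-! ### Assembly of the theorem. -/

theorem mainTheorem5 (k : ℕ) (hk : 1 ≤ k) :
    -- the roots of the indicial polynomial, listed as `r`, with `r i₀ = -2`
    ∃ (r : Fin k → ℂ) (i₀ : Fin k),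
      Function.Injective r ∧
      Set.range r = {z : ℂ | (MultipivotQuicksort.indicialPoly k).IsRoot z} ∧
      r i₀ = -2 ∧
      (∀ i, i ≠ i₀ → -2 < (r i).re ∧ (r i).re ≤ k + 1) ∧
      (∀ x : ℝ, (∃ i, r i = (x : ℂ)) ↔ x = -2 ∨ (Even k ∧ x = k + 1)) ∧
      (Finset.univ.filter (fun i => 0 < (r i).im)).card = (k - 1) / 2 ∧
      (∀ i, (fun n : ℕ => (-1 : ℂ) ^ n * Ring.choose (r i) n)
        =O[Filter.atTop] (fun n : ℕ => (n : ℝ) ^ (-((r i).re + 1)))) ∧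
      (Matrix.vandermonde r).det ≠ 0 ∧
      -- expected cost for an arbitrary toll with linear average
      (∀ (τ : List ℕ → ℝ) (a b : ℝ), MultipivotQuicksort.HasAverageToll k τ a b →
        -- initial values and recurrence
        (∀ n < k, MultipivotQuicksort.expectedCost k τ n = 0) ∧
        (∀ n, k ≤ n →
          (n.choose k : ℝ) * MultipivotQuicksort.expectedCost k τ n
            = (n.choose k : ℝ) * (a * n + b)
              + (k + 1) * ∑ i ∈ Finset.Icc 1 (n - k + 1),
                  ((n - i).choose (k - 1) : ℝ) * MultipivotQuicksort.expectedCost k τ (i - 1)) ∧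
        -- Cauchy–Euler equation for the generating function
        (∀ x : ℂ, ‖x‖ < 1 →
          Summable (fun n : ℕ => (MultipivotQuicksort.expectedCost k τ n : ℂ) * x ^ n) ∧
          iteratedDeriv k (MultipivotQuicksort.genFun k τ) x * (1 - x) ^ k / (k.factorial : ℂ)
            = (a * (x + k) + b * (1 - x)) / (1 - x) ^ 2
              + (k + 1) * MultipivotQuicksort.genFun k τ x) ∧
        -- the integration constants: unique solution of a Vandermonde system
        (∃! s : Fin k → ℂ, MultipivotQuicksort.IsIntegrationConstants k a b r s) ∧
        (∀ s : Fin k → ℂ, MultipivotQuicksort.IsIntegrationConstants k a b r s ↔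
          (Matrix.vandermonde r).transpose.mulVec s = fun m : Fin k =>
            ∑ j ∈ Finset.range ((m : ℕ) + 1),
              (Nat.stirlingSecond m j : ℂ) * (MultipivotQuicksort.sysRHS k a b j : ℂ)) ∧
        ∀ s : Fin k → ℂ, MultipivotQuicksort.IsIntegrationConstants k a b r s →
          (s i₀).im = 0 ∧
          -- solution of the differential equation
          (∀ x : ℂ, ‖x‖ < 1 →
            MultipivotQuicksort.genFun k τ x
              = -(MultipivotQuicksort.lead k a : ℂ) * Complex.log (1 - x) / (1 - x) ^ 2
                + (1 / (k : ℂ)) * ((a - b : ℂ) / (1 - x)) + ∑ i, s i * (1 - x) ^ (r i)) ∧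
          -- exact expected cost
          (∀ n : ℕ, (MultipivotQuicksort.expectedCost k τ n : ℂ)
            = (MultipivotQuicksort.lead k a * ((n + 1) * MultipivotQuicksort.H n - n) : ℝ)
              + ∑ i, s i * ((-1) ^ n * Ring.choose (r i) n) + (a - b : ℂ) / k) ∧
          -- asymptotic expansions
          (fun n : ℕ => MultipivotQuicksort.expectedCost k τ n
              - (MultipivotQuicksort.lead k a * ((n + 1) * MultipivotQuicksort.H n - n)
                + (s i₀).re * (n + 1)
                + 2 * ∑ i ∈ Finset.univ.filter (fun i => 0 < (r i).im),
                    (-1) ^ n * (s i * Ring.choose (r i) n).re))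
            =O[Filter.atTop] (fun _ : ℕ => (1 : ℝ)) ∧
          (fun n : ℕ => MultipivotQuicksort.expectedCost k τ n
              - (MultipivotQuicksort.lead k a * ((n + 1) * MultipivotQuicksort.H n - n)
                + (s i₀).re * (n + 1)))
            =o[Filter.atTop] (fun n : ℕ => (n : ℝ)) ∧
          (fun n : ℕ => MultipivotQuicksort.expectedCost k τ n
              - (MultipivotQuicksort.lead k a * (n * Real.log n)
                + ((s i₀).re
                    + MultipivotQuicksort.lead k a * (Real.eulerMascheroniConstant - 1)) * n))
            =o[Filter.atTop] (fun n : ℕ => (n : ℝ)) ∧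
          (fun n : ℕ => MultipivotQuicksort.expectedCost k τ n
              - MultipivotQuicksort.lead k a * (n * Real.log n))
            =O[Filter.atTop] (fun n : ℕ => (n : ℝ))) ∧
      -- partitioning stages: toll one, that is `a = 0`, `b = 1`
      (∀ s : Fin k → ℂ, MultipivotQuicksort.IsIntegrationConstants k 0 1 r s →
        (Matrix.vandermonde r).transpose.mulVec s = (fun m : Fin k => (-1 : ℂ) ^ (m : ℕ) / k) ∧
        (∀ i, s i = (-1 : ℂ) ^ (k - 1) * (∏ j ∈ Finset.univ.erase i, (r j + 1))
          / (k * ∏ j ∈ Finset.univ.erase i, (r i - r j))) ∧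
        s i₀ = ((1 / ((k + 1) * (MultipivotQuicksort.H (k + 1) - 1)) : ℝ) : ℂ)) ∧
      (fun n : ℕ => MultipivotQuicksort.expectedStages k n
          - (n + 1) / ((k + 1) * (MultipivotQuicksort.H (k + 1) - 1)))
        =o[Filter.atTop] (fun n : ℕ => (n : ℝ)) := by
  obtain ⟨k, rfl⟩ : ∃ m, k = m + 1 := ⟨k - 1, by omega⟩
  obtain ⟨r, hinj, hr⟩ := MultipivotQuicksort.exists_roots hk
  have hroot : ∀ i, (MultipivotQuicksort.indicialPoly (k + 1)).IsRoot (r i) := fun i => by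
    have : r i ∈ Set.range r := ⟨i, rfl⟩
    rwa [hr] at this
  have hex : ∀ z, (MultipivotQuicksort.indicialPoly (k + 1)).IsRoot z → ∃ i, r i = z := fun z h => by
    have : z ∈ Set.range r := by rw [hr]; exact h
    exact this
  obtain ⟨i₀, h0⟩ := hex _ (MultipivotQuicksort.isRoot_neg_two (k + 1))
  refine ⟨r, i₀, hinj, hr, h0, ?_, ?_, MultipivotQuicksort.card_pos_im hk hinj hr,
    fun i => MultipivotQuicksort.binomCoeff_isBigO (r i),
    Matrix.det_vandermonde_ne_zero_iff.mpr hinj, ?_, ?_, ?_⟩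
  · intro i hi
    refine ⟨MultipivotQuicksort.neg_two_lt_re hk (hroot i) ?_,
      MultipivotQuicksort.re_le_succ hk (hroot i)⟩
    rw [← h0]
    exact fun h => hi (hinj h)
  · intro x
    constructor
    · rintro ⟨i, hi⟩
      exact MultipivotQuicksort.real_root hk (hi ▸ hroot i)
    · rintro (rfl | ⟨he, rfl⟩)
      · exact ⟨i₀, by rw [h0]; simp⟩
      · obtain ⟨i, hi⟩ := hex _ (MultipivotQuicksort.isRoot_succ he)
        exact ⟨i, by rw [hi]; simp⟩
  · intro τ a b hτ
    have hunique := MultipivotQuicksort.existsUnique_integrationConstants a b hinj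
    -- Convergence of the generating function is read off from the closed form, so some solution of
    -- the system is needed before the differential equation.
    obtain ⟨s₁, hs₁⟩ := hunique.exists
    have hsum : ∀ x : ℂ, ‖x‖ < 1 → Summable
        (fun n : ℕ => (MultipivotQuicksort.expectedCost (k + 1) τ n : ℂ) * x ^ n) :=
      fun x hx => (MultipivotQuicksort.hasSum_expectedCost hτ hroot hs₁ hx).summable
    refine ⟨fun n hn => MultipivotQuicksort.expectedCost_of_lt τ hn, ?_, ?_, hunique,
      MultipivotQuicksort.isIntegrationConstants_iff r, ?_⟩
    · intro n hn
      rw [MultipivotQuicksort.expectedCost_recurrence hτ hn, Nat.add_sub_cancel,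
        MultipivotQuicksort.sum_Icc_choose_eq_sum_range hn]
      push_cast
      ring
    · exact fun x hx => ⟨hsum x hx, MultipivotQuicksort.genFun_ode hτ hsum hx⟩
    · intro s hs
      refine ⟨MultipivotQuicksort.integrationConstant_im_eq_zero hinj hr h0 hs,
        fun x hx => (MultipivotQuicksort.hasSum_expectedCost hτ hroot hs hx).tsum_eq, ?_,
        MultipivotQuicksort.expectedCost_sub_isBigO_one hτ hinj hr h0 hs,
        MultipivotQuicksort.expectedCost_sub_isLittleO hτ hinj hr h0 hs,
        MultipivotQuicksort.expectedCost_sub_log_isLittleO hτ hinj hr h0 hs,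
        MultipivotQuicksort.expectedCost_sub_log_isBigO hτ hinj hr h0 hs⟩
      intro n
      rw [MultipivotQuicksort.expectedCost_eq hτ hroot hs]
      simp only [MultipivotQuicksort.binomCoeff]
      push_cast
      ring
  · exact fun s hs => ⟨MultipivotQuicksort.vandermonde_system_of_const_toll hs,
      MultipivotQuicksort.integrationConstants_const_toll hinj hs,
      MultipivotQuicksort.integrationConstant_neg_two hk hinj hr hs h0⟩
  · obtain ⟨s, hs, -⟩ := MultipivotQuicksort.existsUnique_integrationConstants 0 1 hinj
    have h1 := MultipivotQuicksort.expectedCost_sub_isLittleO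
      (MultipivotQuicksort.hasAverageToll_one (k + 1)) hinj hr h0 hs
    rw [MultipivotQuicksort.integrationConstant_neg_two hk hinj hr hs h0, Complex.ofReal_re,
      MultipivotQuicksort.lead] at h1
    refine h1.congr_left fun n => ?_
    rw [MultipivotQuicksort.expectedStages]
    ring
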